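/- Let $\gamma\in(0,2\pi)$ with $\gamma\notin\{\pi/2,\pi,3\pi/2\}$, put $c=\cos\gamma$, $s=\sin\gamma$, and let $\nu_0,\nu_1\in\mathbb C$ satisfy $|\nu_0|^2+|\nu_1|^2=1$. The generalized alternate quantum walk is the following discrete-time walk on $\mathbb Z^2$ with a two-dimensional coin, whose state is given by amplitudes $\psi(x,y)\in\mathbb C^2$, $(x,y)\in\mathbb Z^2$. The initial state is $\psi_0(0,0)=(\nu_0,\nu_1)^T$ and $\psi_0(x,y)=0$ for $(x,y)\ne(0,0)$. One time step consists of four operations in this order: apply the coin matrix $U=\begin{pmatrix}c&s\\ s&-c\end{pmatrix}$ at every site; shift along $x$, i.e. $|x,y,0\rangle\mapsto|x-1,y,0\rangle$, $|x,y,1\rangle\mapsto|x+1,y,1\rangle$; apply $U$ at every site again; shift along $y$, i.e. $|x,y,0\rangle\mapsto|x,y-1,0\rangle$, $|x,y,1\rangle\mapsto|x,y+1,1\rangle$. Let $\psi_t$ be the state after $t$ steps and let $(X_t,Y_t)$ be a random vector in $\mathbb Z^2$ with $P[(X_t,Y_t)=(x,y)]=\langle\psi_t(x,y),\psi_t(x,y)\rangle$.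 Put $D=\left\{(x,y)\in\mathbb R^2:\frac{(x+y)^2}{4c^2}+\frac{(x-y)^2}{4s^2}<1\right\}$ and $$f(x,y)=\frac{1}{\pi^2(1-x^2)(1-y^2)}\left\{1-(|\nu_0|^2-|\nu_1|^2)\,y-\frac{\nu_0\overline{\nu_1}+\overline{\nu_0}\nu_1}{2cs}\left[c^2(x-y)+s^2(x+y)\right]\right\}$$ for $(x,y)\in D$, and $f(x,y)=0$ for $(x,y)\notin D$. Then $f$ is a probability density on $\mathbb R^2$ (it is nonnegative, integrable and has integral $1$), the vectors $(X_t/t,Y_t/t)$ converge in distribution, as $t\to\infty$, to the law with density $f$, and for all $x,y\in\mathbb R$ $$\lim_{t\to\infty}P\left(\frac{X_t}{t}\le x,\ \frac{Y_t}{t}\le y\right)=\int_{-\infty}^x du\int_{-\infty}^y dv\,f(u,v).$$ -/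

import Mathlib

open MeasureTheory ProbabilityTheory Filter Topology
open scoped ENNReal

namespace AlternateWalk

/-- A state of the walk, given by its amplitudes: `ψ (x, y) j` is the coefficient `β_{x,y,j}` of the
basis vector `|x, y, j⟩`, and `ψ (x, y)` is the coin vector at the site `(x, y)`. -/
abbrev State : Type := ℤ × ℤ → Fin 2 → ℂ

/-- The coin matrix `U = (c s; s -c)` with `c = cos γ`, `s = sin γ`. -/
noncomputable def coin (γ : ℝ) : Matrix (Fin 2) (Fin 2) ℂ :=
  !![(Real.cos γ : ℂ), (Real.sin γ : ℂ); (Real.sin γ : ℂ), -(Real.cos γ : ℂ)]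

/-- The coin operation: `U` is applied to the coin vector at every site. -/
noncomputable def applyCoin (γ : ℝ) (ψ : State) : State :=
  fun p => (coin γ).mulVec (ψ p)

/-- The conditional shift along `x`: `|x, y, 0⟩ ↦ |x - 1, y, 0⟩` and `|x, y, 1⟩ ↦ |x + 1, y, 1⟩`. -/
def shiftX (ψ : State) : State :=
  fun p => ![ψ (p.1 + 1, p.2) 0, ψ (p.1 - 1, p.2) 1]

/-- The conditional shift along `y`: `|x, y, 0⟩ ↦ |x, y - 1, 0⟩` and `|x, y, 1⟩ ↦ |x, y + 1, 1⟩`. -/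
def shiftY (ψ : State) : State :=
  fun p => ![ψ (p.1, p.2 + 1) 0, ψ (p.1, p.2 - 1) 1]

/-- One time step: coin operation, movement on `x`, coin operation, movement on `y`. -/
noncomputable def step (γ : ℝ) (ψ : State) : State :=
  shiftY (applyCoin γ (shiftX (applyCoin γ ψ)))

/-- The initial state: the walker is at the origin, with coin state `ν₀ |0⟩ + ν₁ |1⟩`. -/
noncomputable def initial (ν₀ ν₁ : ℂ) : State :=
  fun p => if p = (0, 0) then ![ν₀, ν₁] else ![0, 0]

/-- The state after `t` time steps. -/
noncomputable def state (γ : ℝ) (ν₀ ν₁ : ℂ) (t : ℕ) : State :=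
  (step γ)^[t] (initial ν₀ ν₁)

/-- The squared norm `⟨ψ(x, y), ψ(x, y)⟩` of the coin vector at the site `p = (x, y)`. -/
noncomputable def siteProb (ψ : State) (p : ℤ × ℤ) : ℝ :=
  ∑ j, ‖ψ p j‖ ^ 2

/-- The total mass of a state. -/
noncomputable def mass (ψ : State) : ℝ≥0∞ :=
  ∑' p, ENNReal.ofReal (siteProb ψ p)

theorem mass_eq (ψ : State) :
    mass ψ = ∑' p, ENNReal.ofReal (‖ψ p 0‖ ^ 2) + ∑' p, ENNReal.ofReal (‖ψ p 1‖ ^ 2) := by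
  rw [← ENNReal.tsum_add]
  refine tsum_congr fun p => ?_
  rw [siteProb, Fin.sum_univ_two, ENNReal.ofReal_add (by positivity) (by positivity)]

theorem mass_shiftX (ψ : State) : mass (shiftX ψ) = mass ψ := by
  rw [mass_eq, mass_eq]
  congr 1
  · exact (Equiv.prodCongr (Equiv.addRight (1 : ℤ)) (Equiv.refl ℤ)).tsum_eq
      (fun p : ℤ × ℤ => ENNReal.ofReal (‖ψ p 0‖ ^ 2))
  · exact (Equiv.prodCongr (Equiv.subRight (1 : ℤ)) (Equiv.refl ℤ)).tsum_eq
      (fun p : ℤ × ℤ => ENNReal.ofReal (‖ψ p 1‖ ^ 2))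

theorem mass_shiftY (ψ : State) : mass (shiftY ψ) = mass ψ := by
  rw [mass_eq, mass_eq]
  congr 1
  · exact (Equiv.prodCongr (Equiv.refl ℤ) (Equiv.addRight (1 : ℤ))).tsum_eq
      (fun p : ℤ × ℤ => ENNReal.ofReal (‖ψ p 0‖ ^ 2))
  · exact (Equiv.prodCongr (Equiv.refl ℤ) (Equiv.subRight (1 : ℤ))).tsum_eq
      (fun p : ℤ × ℤ => ENNReal.ofReal (‖ψ p 1‖ ^ 2))

theorem mass_applyCoin (γ : ℝ) (ψ : State) : mass (applyCoin γ ψ) = mass ψ := by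
  refine tsum_congr fun p => ?_
  congr 1
  have h := Real.sin_sq_add_cos_sq γ
  simp only [siteProb, Fin.sum_univ_two, applyCoin, coin, Matrix.mulVec, dotProduct,
    Matrix.of_apply, Matrix.cons_val_zero, Matrix.cons_val_one, Complex.sq_norm,
    Complex.normSq_apply, Complex.add_re, Complex.add_im, Complex.mul_re, Complex.mul_im,
    Complex.neg_re, Complex.neg_im, Complex.ofReal_re, Complex.ofReal_im]
  linear_combination ((ψ p 0).re ^ 2 + (ψ p 0).im ^ 2 + (ψ p 1).re ^ 2 + (ψ p 1).im ^ 2) * h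

theorem mass_state (γ : ℝ) {ν₀ ν₁ : ℂ} (hν : ‖ν₀‖ ^ 2 + ‖ν₁‖ ^ 2 = 1) (t : ℕ) :
    mass (state γ ν₀ ν₁ t) = 1 := by
  induction t with
  | zero =>
    rw [mass, tsum_eq_single ((0, 0) : ℤ × ℤ)]
    · simp [state, initial, siteProb, Fin.sum_univ_two, hν]
    · intro p hp
      simp [state, initial, siteProb, Fin.sum_univ_two, hp]
  | succ t ih =>
    rw [← ih]
    simp only [state, Function.iterate_succ_apply', step]
    rw [mass_shiftY, mass_applyCoin, mass_shiftX, mass_applyCoin]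

/-- The distribution of the position of the walker at time `t`: the site `(x, y)` has probability
`⟨ψ_t(x, y), ψ_t(x, y)⟩`. -/
noncomputable def positionPMF (γ : ℝ) (ν₀ ν₁ : ℂ) (hν : ‖ν₀‖ ^ 2 + ‖ν₁‖ ^ 2 = 1) (t : ℕ) :
    PMF (ℤ × ℤ) :=
  ⟨fun p => ENNReal.ofReal (siteProb (state γ ν₀ ν₁ t) p), by
    have h := mass_state γ hν t
    rw [mass] at h
    rw [← h]
    exact ENNReal.summable.hasSum⟩

/-- The open elliptic region `D`. -/
def ellipse (γ : ℝ) : Set (ℝ × ℝ) :=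
  {p | (p.1 + p.2) ^ 2 / (4 * Real.cos γ ^ 2) + (p.1 - p.2) ^ 2 / (4 * Real.sin γ ^ 2) < 1}

/-- The limit density `f`. The number `ν₀ ν₁* + ν₀* ν₁` is real, so taking its real part only changes
its type. -/
noncomputable def limitDensity (γ : ℝ) (ν₀ ν₁ : ℂ) (x y : ℝ) : ℝ :=
  (ellipse γ).indicator (fun _ =>
    1 / (Real.pi ^ 2 * (1 - x ^ 2) * (1 - y ^ 2)) *
      (1 - (‖ν₀‖ ^ 2 - ‖ν₁‖ ^ 2) * y -
        (ν₀ * star ν₁ + star ν₀ * ν₁).re / (2 * Real.cos γ * Real.sin γ) *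
          (Real.cos γ ^ 2 * (x - y) + Real.sin γ ^ 2 * (x + y)))) (x, y)

/-- The measure on the plane with density `f` with respect to Lebesgue measure. -/
noncomputable def limitLaw (γ : ℝ) (ν₀ ν₁ : ℂ) : Measure (ℝ × ℝ) :=
  volume.withDensity fun p => ENNReal.ofReal (limitDensity γ ν₀ ν₁ p.1 p.2)

end AlternateWalk

namespace AlternateWalk

/-! The characteristic function of the rescaled position is computed in momentum space. The Fourier
transform turns one time step into multiplication by a unitary matrix W(k) of determinant 1, so W =
cos θ + sin θ J with a quasi-energy θ(k) and an anti-Hermitian J(k), J² = -1, and W^t = cos(tθ) +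
sin(tθ) J (`walkMatrix_pow`). By Parseval (`tsum_siteProb_state`) the characteristic function at h/t
is the mean over k of ⟨W(k)^t v, W(k - h/t)^t v⟩. Occupied sites have coordinates of the parity of
t, so the square (0, π)² replaces the full torus.

As t → ∞, t (θ(k - h/t) - θ(k)) → -h·∇θ, and the overlap tends to cos(h·∇θ) - sin(h·∇θ) ⟨v, Jv⟩
(`tendsto_overlap`); dominated convergence passes this to the integral.

The limit density appears by the change of variables q = ∇θ(k). On (0, π)² this map is injective
with image D (`injOn_velocity`, `image_velocity`), and its Jacobian is (1 - x²)(1 - y²) in absolute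
value (`abs_det_velocityDeriv`), which cancels the denominator of f. What remains on the square is
the coin factor divided by π². It meets the limiting overlap through the reflection k ↦ (π, π) - k:
this reverses ∇θ, and symmetrizing under it turns ⟨v, Jv⟩ into the coin factor
(`rotor_form_sub_reflect`, `integral_limitOverlap`).

The same change of variables gives nonnegativity, integrability and total mass of f. Lévy's theorem
yields weak convergence, and quadrants have null frontier for a law with a density. -/

/-! ### Quasi-energy, group velocity and its Jacobian -/

/-- The cosine of the quasi-energy at wave number `p`. -/
noncomputable def phaseCos (C : ℝ) (p : ℝ × ℝ) : ℝ :=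
  Real.cos p.1 * Real.cos p.2 - C * (Real.sin p.1 * Real.sin p.2)

/-- The sine of the quasi-energy at wave number `p`. -/
noncomputable def phaseSin (C : ℝ) (p : ℝ × ℝ) : ℝ := √(1 - phaseCos C p ^ 2)

/-- The numerator of the first component of the group velocity. -/
noncomputable def numX (C : ℝ) (p : ℝ × ℝ) : ℝ :=
  Real.sin p.1 * Real.cos p.2 + C * (Real.cos p.1 * Real.sin p.2)

/-- The numerator of the second component of the group velocity. -/
noncomputable def numY (C : ℝ) (p : ℝ × ℝ) : ℝ :=
  Real.cos p.1 * Real.sin p.2 + C * (Real.sin p.1 * Real.cos p.2)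

/-- The group velocity, that is the gradient of the quasi-energy. -/
noncomputable def velocity (C : ℝ) (p : ℝ × ℝ) : ℝ × ℝ :=
  (numX C p / phaseSin C p, numY C p / phaseSin C p)

/-- The open square `(0, π)²` of wave numbers. -/
def cell : Set (ℝ × ℝ) := Set.Ioo 0 Real.pi ×ˢ Set.Ioo 0 Real.pi

theorem measurableSet_cell : MeasurableSet cell := measurableSet_Ioo.prod measurableSet_Ioo

theorem sin_pos_of_mem_cell {p : ℝ × ℝ} (hp : p ∈ cell) :
    0 < Real.sin p.1 ∧ 0 < Real.sin p.2 :=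
  ⟨Real.sin_pos_of_mem_Ioo hp.1, Real.sin_pos_of_mem_Ioo hp.2⟩

/-- `phaseCos` and `numX` are the coordinates of (cos p₂, C sin p₂) rotated by the angle p₁, so
their squares add up to cos² p₂ + C² sin² p₂. -/
theorem one_sub_phaseCos_sq (C : ℝ) (p : ℝ × ℝ) :
    1 - phaseCos C p ^ 2 = (numX C p) ^ 2 + (1 - C ^ 2) * Real.sin p.2 ^ 2 := by
  have h1 := Real.sin_sq_add_cos_sq p.1
  have h2 := Real.sin_sq_add_cos_sq p.2
  simp only [phaseCos, numX]
  linear_combination (-(Real.cos p.2 ^ 2) - C ^ 2 * Real.sin p.2 ^ 2) * h1 - h2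

theorem one_sub_phaseCos_sq' (C : ℝ) (p : ℝ × ℝ) :
    1 - phaseCos C p ^ 2 = (numY C p) ^ 2 + (1 - C ^ 2) * Real.sin p.1 ^ 2 := by
  have h1 := Real.sin_sq_add_cos_sq p.1
  have h2 := Real.sin_sq_add_cos_sq p.2
  simp only [phaseCos, numY]
  linear_combination (-(Real.cos p.1 ^ 2) - C ^ 2 * Real.sin p.1 ^ 2) * h2 - h1

theorem phaseCos_sq_lt_one {C : ℝ} (hC : C ^ 2 < 1) {p : ℝ × ℝ} (hp : p ∈ cell) :
    phaseCos C p ^ 2 < 1 := by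
  have h := one_sub_phaseCos_sq C p
  have h1 := (sin_pos_of_mem_cell hp).2
  have : 0 < (1 - C ^ 2) * Real.sin p.2 ^ 2 := mul_pos (by linarith) (by positivity)
  nlinarith [sq_nonneg (numX C p)]

theorem phaseSin_pos {C : ℝ} (hC : C ^ 2 < 1) {p : ℝ × ℝ} (hp : p ∈ cell) :
    0 < phaseSin C p :=
  Real.sqrt_pos.2 (by linarith [phaseCos_sq_lt_one hC hp])

theorem phaseSin_sq {C : ℝ} (hC : C ^ 2 < 1) {p : ℝ × ℝ} (hp : p ∈ cell) :
    phaseSin C p ^ 2 = 1 - phaseCos C p ^ 2 :=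
  Real.sq_sqrt (by linarith [phaseCos_sq_lt_one hC hp])

theorem one_sub_velocity_fst_sq {C : ℝ} (hC : C ^ 2 < 1) {p : ℝ × ℝ} (hp : p ∈ cell) :
    1 - (velocity C p).1 ^ 2 = (1 - C ^ 2) * Real.sin p.2 ^ 2 / phaseSin C p ^ 2 := by
  have h := phaseSin_pos hC hp
  have h1 := phaseSin_sq hC hp
  rw [one_sub_phaseCos_sq] at h1
  simp only [velocity]
  field_simp
  linarith

theorem one_sub_velocity_snd_sq {C : ℝ} (hC : C ^ 2 < 1) {p : ℝ × ℝ} (hp : p ∈ cell) :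
    1 - (velocity C p).2 ^ 2 = (1 - C ^ 2) * Real.sin p.1 ^ 2 / phaseSin C p ^ 2 := by
  have h := phaseSin_pos hC hp
  have h1 := phaseSin_sq hC hp
  rw [one_sub_phaseCos_sq'] at h1
  simp only [velocity]
  field_simp
  linarith

theorem hasFDerivAt_phaseCos (C : ℝ) (p : ℝ × ℝ) :
    HasFDerivAt (phaseCos C)
      ((-numX C p) • ContinuousLinearMap.fst ℝ ℝ ℝ + (-numY C p) • ContinuousLinearMap.snd ℝ ℝ ℝ)
      p := by
  have s1 := (Real.hasDerivAt_sin p.1).comp_hasFDerivAt p (hasFDerivAt_fst (𝕜 := ℝ) (p := p))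
  have s2 := (Real.hasDerivAt_sin p.2).comp_hasFDerivAt p (hasFDerivAt_snd (𝕜 := ℝ) (p := p))
  have c1 := (Real.hasDerivAt_cos p.1).comp_hasFDerivAt p (hasFDerivAt_fst (𝕜 := ℝ) (p := p))
  have c2 := (Real.hasDerivAt_cos p.2).comp_hasFDerivAt p (hasFDerivAt_snd (𝕜 := ℝ) (p := p))
  convert! (c1.mul c2).sub ((s1.mul s2).const_mul C) using 1
  ext <;> simp [numX, numY] <;> ring

/-- The Hessian entry `m` in `∂²θ = (m - w x y) / r`. -/
noncomputable def mixed (C : ℝ) (p : ℝ × ℝ) : ℝ :=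
  C * (Real.cos p.1 * Real.cos p.2) - Real.sin p.1 * Real.sin p.2

theorem hasFDerivAt_numX (C : ℝ) (p : ℝ × ℝ) :
    HasFDerivAt (numX C)
      (phaseCos C p • ContinuousLinearMap.fst ℝ ℝ ℝ + mixed C p • ContinuousLinearMap.snd ℝ ℝ ℝ)
      p := by
  have s1 := (Real.hasDerivAt_sin p.1).comp_hasFDerivAt p (hasFDerivAt_fst (𝕜 := ℝ) (p := p))
  have s2 := (Real.hasDerivAt_sin p.2).comp_hasFDerivAt p (hasFDerivAt_snd (𝕜 := ℝ) (p := p))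
  have c1 := (Real.hasDerivAt_cos p.1).comp_hasFDerivAt p (hasFDerivAt_fst (𝕜 := ℝ) (p := p))
  have c2 := (Real.hasDerivAt_cos p.2).comp_hasFDerivAt p (hasFDerivAt_snd (𝕜 := ℝ) (p := p))
  convert! (s1.mul c2).add ((c1.mul s2).const_mul C) using 1
  ext <;> simp [phaseCos, mixed] <;> ring

theorem hasFDerivAt_numY (C : ℝ) (p : ℝ × ℝ) :
    HasFDerivAt (numY C)
      (mixed C p • ContinuousLinearMap.fst ℝ ℝ ℝ + phaseCos C p • ContinuousLinearMap.snd ℝ ℝ ℝ)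
      p := by
  have s1 := (Real.hasDerivAt_sin p.1).comp_hasFDerivAt p (hasFDerivAt_fst (𝕜 := ℝ) (p := p))
  have s2 := (Real.hasDerivAt_sin p.2).comp_hasFDerivAt p (hasFDerivAt_snd (𝕜 := ℝ) (p := p))
  have c1 := (Real.hasDerivAt_cos p.1).comp_hasFDerivAt p (hasFDerivAt_fst (𝕜 := ℝ) (p := p))
  have c2 := (Real.hasDerivAt_cos p.2).comp_hasFDerivAt p (hasFDerivAt_snd (𝕜 := ℝ) (p := p))
  convert! (c1.mul s2).add ((s1.mul c2).const_mul C) using 1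
  ext <;> simp [phaseCos, mixed] <;> ring

theorem hasFDerivAt_phaseSin {C : ℝ} (hC : C ^ 2 < 1) {p : ℝ × ℝ} (hp : p ∈ cell) :
    HasFDerivAt (phaseSin C)
      ((phaseCos C p * numX C p / phaseSin C p) • ContinuousLinearMap.fst ℝ ℝ ℝ +
        (phaseCos C p * numY C p / phaseSin C p) • ContinuousLinearMap.snd ℝ ℝ ℝ) p := by
  have h := phaseSin_pos hC hp
  have h1 := phaseCos_sq_lt_one hC hp
  have := (((hasFDerivAt_phaseCos C p).pow 2).const_sub 1).sqrt (by linarith)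
  convert! this using 1
  change _ = (1 / (2 * phaseSin C p)) • _
  ext <;> simp <;> field_simp

/-- The derivative of the group velocity. -/
noncomputable def velocityDeriv (C : ℝ) (p : ℝ × ℝ) : ℝ × ℝ →L[ℝ] ℝ × ℝ :=
  (Matrix.toLin (Module.Basis.finTwoProd ℝ) (Module.Basis.finTwoProd ℝ)
    !![phaseCos C p * (1 - (velocity C p).1 ^ 2) / phaseSin C p,
      (mixed C p - phaseCos C p * (velocity C p).1 * (velocity C p).2) / phaseSin C p;
      (mixed C p - phaseCos C p * (velocity C p).1 * (velocity C p).2) / phaseSin C p,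
      phaseCos C p * (1 - (velocity C p).2 ^ 2) / phaseSin C p]).toContinuousLinearMap

theorem hasFDerivAt_velocity {C : ℝ} (hC : C ^ 2 < 1) {p : ℝ × ℝ} (hp : p ∈ cell) :
    HasFDerivAt (velocity C) (velocityDeriv C p) p := by
  have h := phaseSin_pos hC hp
  unfold velocityDeriv
  rw [Matrix.toLin_finTwoProd_toContinuousLinearMap]
  have hi := (hasDerivAt_inv h.ne').comp_hasFDerivAt p (hasFDerivAt_phaseSin hC hp)
  convert! ((hasFDerivAt_numX C p).mul hi).prodMk ((hasFDerivAt_numY C p).mul hi) using 2 <;>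
  ext <;> simp [velocity] <;> field_simp <;> ring

/-- Puts the off-diagonal Hessian entry of θ in closed form: it equals -(1 - C²) sin p₁ sin p₂ / r³
with r = sin θ. -/
theorem mixed_mul_sub (C : ℝ) (p : ℝ × ℝ) :
    mixed C p * (1 - phaseCos C p ^ 2) - phaseCos C p * numX C p * numY C p =
      -((1 - C ^ 2) * (Real.sin p.1 * Real.sin p.2)) := by
  have h1 := Real.sin_sq_add_cos_sq p.1
  have h2 := Real.sin_sq_add_cos_sq p.2
  simp only [phaseCos, mixed, numX, numY]
  linear_combination (-(Real.cos p.1 * Real.cos p.2 - C * (Real.sin p.1 * Real.sin p.2)) * C) *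
    ((Real.sin p.2 ^ 2 + Real.cos p.2 ^ 2) * h1 + h2)

/-- With w = cos θ and r = sin θ, the diagonal product is w² (1 - x²)(1 - y²) / r², and the squared
off-diagonal entry is (1 - x²)(1 - y²) / r². Since w² - 1 = -r², the determinant is -(1 - x²)(1 -
y²). -/
theorem abs_det_velocityDeriv {C : ℝ} (hC : C ^ 2 < 1) {p : ℝ × ℝ} (hp : p ∈ cell) :
    |(velocityDeriv C p).det| = (1 - (velocity C p).1 ^ 2) * (1 - (velocity C p).2 ^ 2) := by
  have h := phaseSin_pos hC hp
  have h2 := phaseSin_sq hC hp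
  have hm := mixed_mul_sub C p
  have hs := sin_pos_of_mem_cell hp
  have key : (mixed C p - phaseCos C p * (velocity C p).1 * (velocity C p).2) =
      -((1 - C ^ 2) * (Real.sin p.1 * Real.sin p.2)) / phaseSin C p ^ 2 := by
    rw [eq_div_iff (by positivity), ← hm, ← h2]
    simp only [velocity]
    field_simp
  have : (velocityDeriv C p).det =
      -((1 - (velocity C p).1 ^ 2) * (1 - (velocity C p).2 ^ 2)) := by
    unfold velocityDeriv
    simp only [LinearMap.det_toContinuousLinearMap, LinearMap.det_toLin, Matrix.det_fin_two_of]
    rw [key, one_sub_velocity_fst_sq hC hp, one_sub_velocity_snd_sq hC hp]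
    field_simp
    linear_combination ((1 - C ^ 2) ^ 2 * Real.sin p.1 ^ 2 * Real.sin p.2 ^ 2) * h2
  rw [this, abs_neg, abs_of_nonneg]
  rw [one_sub_velocity_fst_sq hC hp, one_sub_velocity_snd_sq hC hp]
  have : 0 < 1 - C ^ 2 := by linarith
  positivity

/-! ### Inverting the velocity map -/

theorem sqrt_one_sub_velocity_fst_sq {C : ℝ} (hC : C ^ 2 < 1) {p : ℝ × ℝ} (hp : p ∈ cell) :
    √(1 - (velocity C p).1 ^ 2) = √(1 - C ^ 2) * Real.sin p.2 / phaseSin C p := by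
  rw [one_sub_velocity_fst_sq hC hp, Real.sqrt_div' _ (by positivity),
    Real.sqrt_mul (by linarith), Real.sqrt_sq (sin_pos_of_mem_cell hp).2.le,
    Real.sqrt_sq (phaseSin_pos hC hp).le]

theorem sqrt_one_sub_velocity_snd_sq {C : ℝ} (hC : C ^ 2 < 1) {p : ℝ × ℝ} (hp : p ∈ cell) :
    √(1 - (velocity C p).2 ^ 2) = √(1 - C ^ 2) * Real.sin p.1 / phaseSin C p := by
  rw [one_sub_velocity_snd_sq hC hp, Real.sqrt_div' _ (by positivity),
    Real.sqrt_mul (by linarith), Real.sqrt_sq (sin_pos_of_mem_cell hp).1.le,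
    Real.sqrt_sq (phaseSin_pos hC hp).le]

theorem velocity_fst_sub_mul_snd (C : ℝ) (p : ℝ × ℝ) :
    (velocity C p).1 - C * (velocity C p).2 =
      (1 - C ^ 2) * (Real.sin p.1 * Real.cos p.2) / phaseSin C p := by
  simp only [velocity, numX, numY]
  ring

theorem velocity_snd_sub_mul_fst (C : ℝ) (p : ℝ × ℝ) :
    (velocity C p).2 - C * (velocity C p).1 =
      (1 - C ^ 2) * (Real.cos p.1 * Real.sin p.2) / phaseSin C p := by
  simp only [velocity, numX, numY]
  ring

/-- Both y - C x and √(1 - x²) are multiples of sin p₂ / r, which drops out of the quotient.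
Positivity of sin p₂ on the cell fixes the sign of the root. Hence the velocity determines cos p₁,
and so p₁ itself. -/
theorem cos_fst_eq {C : ℝ} (hC : C ^ 2 < 1) {p : ℝ × ℝ} (hp : p ∈ cell) :
    Real.cos p.1 = ((velocity C p).2 - C * (velocity C p).1) /
      (√(1 - C ^ 2) * √(1 - (velocity C p).1 ^ 2)) := by
  have h := phaseSin_pos hC hp
  have hs := (sin_pos_of_mem_cell hp).2
  have hk : 0 < √(1 - C ^ 2) := Real.sqrt_pos.2 (by linarith)
  have hk2 : √(1 - C ^ 2) ^ 2 = 1 - C ^ 2 := Real.sq_sqrt (by linarith)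
  rw [sqrt_one_sub_velocity_fst_sq hC hp, velocity_snd_sub_mul_fst]
  field_simp
  rw [hk2]

theorem cos_snd_eq {C : ℝ} (hC : C ^ 2 < 1) {p : ℝ × ℝ} (hp : p ∈ cell) :
    Real.cos p.2 = ((velocity C p).1 - C * (velocity C p).2) /
      (√(1 - C ^ 2) * √(1 - (velocity C p).2 ^ 2)) := by
  have h := phaseSin_pos hC hp
  have hs := (sin_pos_of_mem_cell hp).1
  have hk : 0 < √(1 - C ^ 2) := Real.sqrt_pos.2 (by linarith)
  have hk2 : √(1 - C ^ 2) ^ 2 = 1 - C ^ 2 := Real.sq_sqrt (by linarith)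
  rw [sqrt_one_sub_velocity_snd_sq hC hp, velocity_fst_sub_mul_snd]
  field_simp
  rw [hk2]

theorem injOn_velocity {C : ℝ} (hC : C ^ 2 < 1) : Set.InjOn (velocity C) cell := by
  intro p hp q hq h
  have h1 := cos_fst_eq hC hp
  have h2 := cos_snd_eq hC hp
  rw [h, ← cos_fst_eq hC hq] at h1
  rw [h, ← cos_snd_eq hC hq] at h2
  exact Prod.ext (Real.injOn_cos (Set.Ioo_subset_Icc_self hp.1) (Set.Ioo_subset_Icc_self hq.1) h1)
    (Real.injOn_cos (Set.Ioo_subset_Icc_self hp.2) (Set.Ioo_subset_Icc_self hq.2) h2)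

theorem arccos_mem_Ioo {z : ℝ} (hz : z ^ 2 < 1) : Real.arccos z ∈ Set.Ioo 0 Real.pi := by
  rw [sq_lt_one_iff_abs_lt_one, abs_lt] at hz
  refine ⟨Real.arccos_pos.2 hz.2, lt_of_le_of_ne (Real.arccos_le_pi z) fun h => ?_⟩
  rw [Real.arccos_eq_pi] at h
  linarith

theorem cos_arccos_of_sq_lt_one {z : ℝ} (hz : z ^ 2 < 1) : Real.cos (Real.arccos z) = z := by
  rw [sq_lt_one_iff_abs_lt_one, abs_lt] at hz
  exact Real.cos_arccos hz.1.le hz.2.le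

/-- The group velocity maps the open square of wave numbers onto an open elliptic region. -/
theorem image_velocity {C : ℝ} (hC : C ^ 2 < 1) :
    velocity C '' cell = {q | q.1 ^ 2 + q.2 ^ 2 - 2 * C * q.1 * q.2 < 1 - C ^ 2} := by
  have hC' : 0 < 1 - C ^ 2 := by linarith
  refine Set.Subset.antisymm ?_ ?_
  · rintro _ ⟨p, hp, rfl⟩
    have h := phaseSin_pos hC hp
    have hs := sin_pos_of_mem_cell hp
    have h1 := one_sub_velocity_snd_sq hC hp
    have h2 := velocity_fst_sub_mul_snd C p
    have e : (velocity C p).1 ^ 2 + (velocity C p).2 ^ 2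
        - 2 * C * (velocity C p).1 * (velocity C p).2 = 1 - C ^ 2 -
          (1 - C ^ 2) ^ 2 * (Real.sin p.1 * Real.sin p.2) ^ 2 / phaseSin C p ^ 2 := by
      have h3 := Real.sin_sq_add_cos_sq p.2
      have : (velocity C p).1 ^ 2 + (velocity C p).2 ^ 2
          - 2 * C * (velocity C p).1 * (velocity C p).2 =
          ((velocity C p).1 - C * (velocity C p).2) ^ 2 + (1 - C ^ 2) -
            (1 - C ^ 2) * (1 - (velocity C p).2 ^ 2) := by ring
      rw [this, h2, h1]
      field_simp
      linear_combination ((1 - C ^ 2) * Real.sin p.1 ^ 2) * h3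
    have : 0 < (1 - C ^ 2) ^ 2 * (Real.sin p.1 * Real.sin p.2) ^ 2 / phaseSin C p ^ 2 := by
      have := hs.1
      have := hs.2
      positivity
    simp only [Set.mem_ofPred_eq]
    linarith
  · rintro ⟨x, y⟩ hq
    simp only [Set.mem_ofPred_eq] at hq
    -- By the first inclusion, a preimage p must satisfy d = (1 - C²) sin p₁ sin p₂ / r.
    set d := √(1 - C ^ 2 - (x ^ 2 + y ^ 2 - 2 * C * x * y)) with hd
    have hd0 : 0 < d := Real.sqrt_pos.2 (by linarith)
    have hd2 : d ^ 2 = 1 - C ^ 2 - (x ^ 2 + y ^ 2 - 2 * C * x * y) := Real.sq_sqrt (by linarith)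
    have ex : d ^ 2 + (y - C * x) ^ 2 = (1 - C ^ 2) * (1 - x ^ 2) := by rw [hd2]; ring
    have ey : d ^ 2 + (x - C * y) ^ 2 = (1 - C ^ 2) * (1 - y ^ 2) := by rw [hd2]; ring
    have hx : 0 < 1 - x ^ 2 := by
      refine pos_of_mul_pos_right ?_ hC'.le
      rw [← ex]; positivity
    have hy : 0 < 1 - y ^ 2 := by
      refine pos_of_mul_pos_right ?_ hC'.le
      rw [← ey]; positivity
    set k := √(1 - C ^ 2)
    have hk : 0 < k := Real.sqrt_pos.2 hC'
    have hk2 : k ^ 2 = 1 - C ^ 2 := Real.sq_sqrt hC'.le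
    set X := √(1 - x ^ 2)
    have hX : 0 < X := Real.sqrt_pos.2 hx
    have hX2 : X ^ 2 = 1 - x ^ 2 := Real.sq_sqrt hx.le
    set Y := √(1 - y ^ 2)
    have hY : 0 < Y := Real.sqrt_pos.2 hy
    have hY2 : Y ^ 2 = 1 - y ^ 2 := Real.sq_sqrt hy.le
    have sa : 1 - ((y - C * x) / (k * X)) ^ 2 = (d / (k * X)) ^ 2 := by
      rw [← hk2, ← hX2] at ex
      field_simp
      linarith
    have sb : 1 - ((x - C * y) / (k * Y)) ^ 2 = (d / (k * Y)) ^ 2 := by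
      rw [← hk2, ← hY2] at ey
      field_simp
      linarith
    have la : ((y - C * x) / (k * X)) ^ 2 < 1 := by
      have : 0 < (d / (k * X)) ^ 2 := by positivity
      linarith
    have lb : ((x - C * y) / (k * Y)) ^ 2 < 1 := by
      have : 0 < (d / (k * Y)) ^ 2 := by positivity
      linarith
    -- The only possible preimage, read off from `cos_fst_eq` and `cos_snd_eq`.
    set p : ℝ × ℝ := (Real.arccos ((y - C * x) / (k * X)), Real.arccos ((x - C * y) / (k * Y)))
      with hp
    have hpc : p ∈ cell := ⟨arccos_mem_Ioo la, arccos_mem_Ioo lb⟩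
    have ca : Real.cos p.1 = (y - C * x) / (k * X) := cos_arccos_of_sq_lt_one la
    have cb : Real.cos p.2 = (x - C * y) / (k * Y) := cos_arccos_of_sq_lt_one lb
    have sa' : Real.sin p.1 = d / (k * X) := by
      rw [hp, Real.sin_arccos, sa, Real.sqrt_sq (by positivity)]
    have sb' : Real.sin p.2 = d / (k * Y) := by
      rw [hp, Real.sin_arccos, sb, Real.sqrt_sq (by positivity)]
    have nx : numX C p = d * x / (X * Y) := by
      rw [numX, ca, cb, sa', sb']
      field_simp
      rw [hk2]
      ring
    have ny : numY C p = d * y / (X * Y) := by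
      rw [numY, ca, cb, sa', sb']
      field_simp
      rw [hk2]
      ring
    have hr : phaseSin C p = d / (X * Y) := by
      rw [phaseSin, one_sub_phaseCos_sq, nx, sb', ← hk2, ← Real.sqrt_sq (by positivity :
        0 ≤ d / (X * Y))]
      congr 1
      field_simp
      linarith
    refine ⟨p, hpc, ?_⟩
    simp only [velocity]
    rw [nx, ny, hr]
    ext <;> field_simp

theorem continuous_phaseSin (C : ℝ) : Continuous (phaseSin C) := by
  unfold phaseSin phaseCos
  fun_prop

theorem measurable_velocity (C : ℝ) : Measurable (velocity C) := by
  have h1 : Continuous (numX C) := by unfold numX; fun_prop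
  have h2 : Continuous (numY C) := by unfold numY; fun_prop
  exact (h1.measurable.div (continuous_phaseSin C).measurable).prodMk
    (h2.measurable.div (continuous_phaseSin C).measurable)

/-! ### The limit density in wave-number coordinates -/

/-- The coupling constant `cos (2 γ)` of the quasi-energy. -/
noncomputable def coupling (γ : ℝ) : ℝ := Real.cos γ ^ 2 - Real.sin γ ^ 2

theorem one_sub_coupling_sq (γ : ℝ) :
    1 - coupling γ ^ 2 = (2 * Real.cos γ * Real.sin γ) ^ 2 := by
  have h := Real.sin_sq_add_cos_sq γ
  rw [coupling]
  linear_combination (-1 - Real.sin γ ^ 2 - Real.cos γ ^ 2) * h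

theorem coupling_sq_lt_one {γ : ℝ} (hc : Real.cos γ ≠ 0) (hs : Real.sin γ ≠ 0) :
    coupling γ ^ 2 < 1 := by
  have h := one_sub_coupling_sq γ
  have : 0 < (2 * Real.cos γ * Real.sin γ) ^ 2 := by positivity
  linarith

theorem ellipse_eq_image {γ : ℝ} (hc : Real.cos γ ≠ 0) (hs : Real.sin γ ≠ 0) :
    ellipse γ = velocity (coupling γ) '' cell := by
  rw [image_velocity (coupling_sq_lt_one hc hs), one_sub_coupling_sq]
  ext ⟨x, y⟩
  simp only [ellipse, Set.mem_ofPred_eq]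
  have h := Real.sin_sq_add_cos_sq γ
  have e : (x + y) ^ 2 / (4 * Real.cos γ ^ 2) + (x - y) ^ 2 / (4 * Real.sin γ ^ 2) =
      (x ^ 2 + y ^ 2 - 2 * coupling γ * x * y) / (2 * Real.cos γ * Real.sin γ) ^ 2 := by
    rw [coupling]
    field_simp
    linear_combination 4 * (x ^ 2 + y ^ 2) * h
  rw [e, div_lt_one (by positivity)]

/-- The factor of the limit density that depends on the initial coin state. -/
noncomputable def coinWeight (γ : ℝ) (ν₀ ν₁ : ℂ) (q : ℝ × ℝ) : ℝ :=
  1 - (‖ν₀‖ ^ 2 - ‖ν₁‖ ^ 2) * q.2 -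
    (ν₀ * star ν₁ + star ν₀ * ν₁).re / (2 * Real.cos γ * Real.sin γ) *
      (Real.cos γ ^ 2 * (q.1 - q.2) + Real.sin γ ^ 2 * (q.1 + q.2))

theorem limitDensity_eq_indicator (γ : ℝ) (ν₀ ν₁ : ℂ) :
    (fun p : ℝ × ℝ => limitDensity γ ν₀ ν₁ p.1 p.2) = (ellipse γ).indicator
      (fun q => 1 / (Real.pi ^ 2 * (1 - q.1 ^ 2) * (1 - q.2 ^ 2)) * coinWeight γ ν₀ ν₁ q) := rfl

/-- The bracket c²(x - y) + s²(x + y) is x - C y, which equals (2cs)² sin p₁ cos p₂ / r on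
velocities; one factor 2cs cancels. -/
theorem coinWeight_velocity (γ : ℝ) (ν₀ ν₁ : ℂ)
    (p : ℝ × ℝ) :
    coinWeight γ ν₀ ν₁ (velocity (coupling γ) p) =
      1 - ((‖ν₀‖ ^ 2 - ‖ν₁‖ ^ 2) * (velocity (coupling γ) p).2 +
        (ν₀ * star ν₁ + star ν₀ * ν₁).re * (2 * Real.cos γ * Real.sin γ *
          (Real.sin p.1 * Real.cos p.2) / phaseSin (coupling γ) p)) := by
  have h := velocity_fst_sub_mul_snd (coupling γ) p
  rw [one_sub_coupling_sq] at h
  have h1 := Real.sin_sq_add_cos_sq γ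
  have e : Real.cos γ ^ 2 * ((velocity (coupling γ) p).1 - (velocity (coupling γ) p).2) +
      Real.sin γ ^ 2 * ((velocity (coupling γ) p).1 + (velocity (coupling γ) p).2) =
      (velocity (coupling γ) p).1 - coupling γ * (velocity (coupling γ) p).2 := by
    rw [coupling]
    linear_combination (velocity (Real.cos γ ^ 2 - Real.sin γ ^ 2) p).1 * h1
  rw [coinWeight, e, h]
  field_simp
  ring

/-- These are two of the three coordinates of the Bloch vector of the coin state, which has length
1. -/
theorem polarization_sq_le {ν₀ ν₁ : ℂ} (hν : ‖ν₀‖ ^ 2 + ‖ν₁‖ ^ 2 = 1) :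
    (‖ν₀‖ ^ 2 - ‖ν₁‖ ^ 2) ^ 2 + (ν₀ * star ν₁ + star ν₀ * ν₁).re ^ 2 ≤ 1 := by
  have e : (ν₀ * star ν₁ + star ν₀ * ν₁).re = 2 * (ν₀.re * ν₁.re + ν₀.im * ν₁.im) := by
    simp
    ring
  rw [e]
  simp only [Complex.sq_norm, Complex.normSq_apply] at hν ⊢
  have h : (ν₀.re * ν₀.re + ν₀.im * ν₀.im + (ν₁.re * ν₁.re + ν₁.im * ν₁.im)) ^ 2 = 1 := by
    rw [hν]; norm_num
  nlinarith [sq_nonneg (ν₀.re * ν₁.im - ν₀.im * ν₁.re)]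

/-- Cauchy–Schwarz: 1 minus the weight is A y + B z, where A² + B² ≤ 1 by `polarization_sq_le` and
z² = (1 - y²) cos² p₂ gives y² + z² ≤ 1. -/
theorem abs_one_sub_coinWeight_le {γ : ℝ} (hc : Real.cos γ ≠ 0) (hs : Real.sin γ ≠ 0) {ν₀ ν₁ : ℂ}
    (hν : ‖ν₀‖ ^ 2 + ‖ν₁‖ ^ 2 = 1) {p : ℝ × ℝ} (hp : p ∈ cell) :
    |1 - coinWeight γ ν₀ ν₁ (velocity (coupling γ) p)| ≤ 1 := by
  rw [coinWeight_velocity]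
  have hC := coupling_sq_lt_one hc hs
  have h1 := one_sub_velocity_snd_sq hC hp
  have hr := phaseSin_pos hC hp
  rw [one_sub_coupling_sq] at h1
  have hA := polarization_sq_le hν
  set A := ‖ν₀‖ ^ 2 - ‖ν₁‖ ^ 2
  set B := (ν₀ * star ν₁ + star ν₀ * ν₁).re
  set y := (velocity (coupling γ) p).2
  set z := 2 * Real.cos γ * Real.sin γ * (Real.sin p.1 * Real.cos p.2) / phaseSin (coupling γ) p
    with hz
  have hz2 : z ^ 2 ≤ 1 - y ^ 2 := by
    have : z ^ 2 = (1 - y ^ 2) * Real.cos p.2 ^ 2 := by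
      rw [h1, hz]
      field_simp
    rw [this]
    refine mul_le_of_le_one_right ?_ (Real.cos_sq_le_one _)
    rw [h1]
    positivity
  rw [sub_sub_cancel]
  refine abs_le_one_iff_mul_self_le_one.2 ?_
  nlinarith [sq_nonneg (A * z - B * y), mul_nonneg (sub_nonneg.2 hz2) (sub_nonneg.2 hA),
    sq_nonneg A, sq_nonneg B, sq_nonneg y, sq_nonneg z]

theorem limitDensity_nonneg {γ : ℝ} (hc : Real.cos γ ≠ 0) (hs : Real.sin γ ≠ 0) {ν₀ ν₁ : ℂ}
    (hν : ‖ν₀‖ ^ 2 + ‖ν₁‖ ^ 2 = 1) (x y : ℝ) : 0 ≤ limitDensity γ ν₀ ν₁ x y := by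
  have h := congrFun (limitDensity_eq_indicator γ ν₀ ν₁) (x, y)
  simp only at h
  rw [h]
  refine Set.indicator_nonneg (fun q hq => ?_) _
  rw [ellipse_eq_image hc hs] at hq
  obtain ⟨p, hp, rfl⟩ := hq
  have hC := coupling_sq_lt_one hc hs
  have hw := abs_le.1 (abs_one_sub_coinWeight_le hc hs hν hp)
  rw [mul_assoc, one_sub_velocity_fst_sq hC hp, one_sub_velocity_snd_sq hC hp]
  have h0 : 0 < 1 - coupling γ ^ 2 := by linarith
  exact mul_nonneg (by positivity) (by linarith)

theorem measurable_coinWeight (γ : ℝ) (ν₀ ν₁ : ℂ) : Measurable (coinWeight γ ν₀ ν₁) := by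
  unfold coinWeight
  fun_prop

theorem measurableSet_ellipse (γ : ℝ) : MeasurableSet (ellipse γ) :=
  measurableSet_lt (by fun_prop) (by fun_prop)

theorem volume_cell : volume cell = ENNReal.ofReal (Real.pi ^ 2) := by
  rw [cell, Measure.volume_eq_prod, Measure.prod_prod, Real.volume_Ioo, sub_zero,
    ← ENNReal.ofReal_mul Real.pi_pos.le, sq]

theorem volume_real_cell : volume.real cell = Real.pi ^ 2 := by
  rw [measureReal_def, volume_cell, ENNReal.toReal_ofReal (by positivity)]

instance : IsFiniteMeasure (volume.restrict cell) :=
  ⟨by simp [volume_cell]⟩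

/-- The Jacobian cancels the denominator (1 - x²)(1 - y²), so the density pulls back to the coin
weight over π². -/
theorem abs_det_smul_density {γ : ℝ} (hc : Real.cos γ ≠ 0) (hs : Real.sin γ ≠ 0) (ν₀ ν₁ : ℂ)
    {E : Type*} [AddCommGroup E] [Module ℝ E] (F : ℝ × ℝ → E) {p : ℝ × ℝ} (hp : p ∈ cell) :
    |(velocityDeriv (coupling γ) p).det| •
      ((1 / (Real.pi ^ 2 * (1 - (velocity (coupling γ) p).1 ^ 2) *
        (1 - (velocity (coupling γ) p).2 ^ 2)) *
          coinWeight γ ν₀ ν₁ (velocity (coupling γ) p)) • F (velocity (coupling γ) p)) =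
      (Real.pi ^ 2)⁻¹ • (coinWeight γ ν₀ ν₁ (velocity (coupling γ) p) •
        F (velocity (coupling γ) p)) := by
  have hC := coupling_sq_lt_one hc hs
  have h0 : 0 < 1 - coupling γ ^ 2 := by linarith
  have hr := phaseSin_pos hC hp
  have hsin := sin_pos_of_mem_cell hp
  have h1 : 0 < 1 - (velocity (coupling γ) p).1 ^ 2 := by
    rw [one_sub_velocity_fst_sq hC hp]
    have := hsin.2
    positivity
  have h2 : 0 < 1 - (velocity (coupling γ) p).2 ^ 2 := by
    rw [one_sub_velocity_snd_sq hC hp]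
    have := hsin.1
    positivity
  rw [abs_det_velocityDeriv hC hp, smul_smul, smul_smul]
  congr 1
  field_simp

/-- Change of variables: integrals against the limit density are integrals over wave numbers. -/
theorem integral_limitDensity_smul {γ : ℝ} (hc : Real.cos γ ≠ 0) (hs : Real.sin γ ≠ 0) (ν₀ ν₁ : ℂ)
    {E : Type*} [NormedAddCommGroup E] [NormedSpace ℝ E] (F : ℝ × ℝ → E) :
    ∫ q : ℝ × ℝ, limitDensity γ ν₀ ν₁ q.1 q.2 • F q =
      (Real.pi ^ 2)⁻¹ • ∫ p in cell, coinWeight γ ν₀ ν₁ (velocity (coupling γ) p) •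
        F (velocity (coupling γ) p) := by
  have hC := coupling_sq_lt_one hc hs
  have e : (fun q : ℝ × ℝ => limitDensity γ ν₀ ν₁ q.1 q.2 • F q) = (ellipse γ).indicator
      (fun q => (1 / (Real.pi ^ 2 * (1 - q.1 ^ 2) * (1 - q.2 ^ 2)) * coinWeight γ ν₀ ν₁ q) •
        F q) := by
    ext q
    have h := congrFun (limitDensity_eq_indicator γ ν₀ ν₁) q
    rw [h, ← Set.indicator_smul_apply_left]
  rw [e, integral_indicator (measurableSet_ellipse γ), ellipse_eq_image hc hs,
    integral_image_eq_integral_abs_det_fderiv_smul volume measurableSet_cell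
      (fun p hp => (hasFDerivAt_velocity hC hp).hasFDerivWithinAt) (injOn_velocity hC),
    ← integral_smul]
  exact setIntegral_congr_fun measurableSet_cell
    fun p hp => abs_det_smul_density hc hs ν₀ ν₁ F hp

theorem integrable_coinWeight_velocity {γ : ℝ} (hc : Real.cos γ ≠ 0) (hs : Real.sin γ ≠ 0)
    {ν₀ ν₁ : ℂ} (hν : ‖ν₀‖ ^ 2 + ‖ν₁‖ ^ 2 = 1) :
    IntegrableOn (fun p => coinWeight γ ν₀ ν₁ (velocity (coupling γ) p)) cell := by
  refine Integrable.of_bound (C := 2)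
    ((measurable_coinWeight γ ν₀ ν₁).comp (measurable_velocity _)).aestronglyMeasurable ?_
  refine ae_restrict_of_forall_mem measurableSet_cell fun p hp => ?_
  have := abs_le.1 (abs_one_sub_coinWeight_le hc hs hν hp)
  rw [Real.norm_eq_abs, abs_le]
  constructor <;> linarith

/-- The factor 1/((1 - x²)(1 - y²)) is unbounded, since the ellipse touches the lines x = ±1 and y =
±1. Pulled back to the cell, the density becomes a bounded function on a set of finite measure. -/
theorem integrable_limitDensity {γ : ℝ} (hc : Real.cos γ ≠ 0) (hs : Real.sin γ ≠ 0)
    {ν₀ ν₁ : ℂ} (hν : ‖ν₀‖ ^ 2 + ‖ν₁‖ ^ 2 = 1) :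
    Integrable (fun p : ℝ × ℝ => limitDensity γ ν₀ ν₁ p.1 p.2) := by
  have hC := coupling_sq_lt_one hc hs
  rw [limitDensity_eq_indicator, integrable_indicator_iff (measurableSet_ellipse γ),
    ellipse_eq_image hc hs, integrableOn_image_iff_integrableOn_abs_det_fderiv_smul volume
      measurableSet_cell (fun p hp => (hasFDerivAt_velocity hC hp).hasFDerivWithinAt)
      (injOn_velocity hC)]
  refine ((integrable_coinWeight_velocity hc hs hν).const_mul (Real.pi ^ 2)⁻¹).congr ?_
  refine ae_restrict_of_forall_mem measurableSet_cell fun p hp => ?_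
  have := abs_det_smul_density hc hs ν₀ ν₁ (fun _ => (1 : ℝ)) hp
  simpa using this.symm

/-! ### Symmetrization under reflection of the cell -/

/-- The point reflection of the cell. -/
noncomputable def reflect (p : ℝ × ℝ) : ℝ × ℝ := (Real.pi, Real.pi) - p

theorem reflect_mem_cell {p : ℝ × ℝ} : reflect p ∈ cell ↔ p ∈ cell := by
  simp [reflect, cell, and_comm]

theorem phaseSin_reflect (C : ℝ) (p : ℝ × ℝ) : phaseSin C (reflect p) = phaseSin C p := by
  simp [reflect, phaseSin, phaseCos]

/-- The reflection keeps both sines and negates both cosines, so the quasi-energy is even and its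
gradient odd. -/
theorem velocity_reflect (C : ℝ) (p : ℝ × ℝ) : velocity C (reflect p) = -velocity C p := by
  have := phaseSin_reflect C p
  ext
  · simp only [velocity, this, Prod.fst_neg]
    simp [reflect, numX]
    ring
  · simp only [velocity, this, Prod.snd_neg]
    simp [reflect, numY]
    ring

theorem integral_reflect {E : Type*} [NormedAddCommGroup E] [NormedSpace ℝ E] (f : ℝ × ℝ → E) :
    ∫ p in cell, f (reflect p) = ∫ p in cell, f p := by
  have h := (Measure.measurePreserving_sub_left (volume : Measure (ℝ × ℝ))
    (Real.pi, Real.pi)).setIntegral_preimage_emb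
    (MeasurableEquiv.subLeft (Real.pi, Real.pi)).measurableEmbedding f cell
  rw [← h]
  congr 2
  ext p
  exact reflect_mem_cell.symm

theorem integrableOn_reflect {E : Type*} [NormedAddCommGroup E] {f : ℝ × ℝ → E}
    (hf : IntegrableOn f cell) : IntegrableOn (fun p => f (reflect p)) cell := by
  have h := (Measure.measurePreserving_sub_left (volume : Measure (ℝ × ℝ))
    (Real.pi, Real.pi)).integrableOn_comp_preimage
    (MeasurableEquiv.subLeft (Real.pi, Real.pi)).measurableEmbedding (f := f) (s := cell)
  have e : (fun p : ℝ × ℝ => (Real.pi, Real.pi) - p) ⁻¹' cell = cell := by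
    ext p
    exact reflect_mem_cell
  rw [e] at h
  exact h.2 hf

/-- Functions with the same symmetrization have the same integral over the cell. -/
theorem integral_eq_of_add_reflect_eq {E : Type*} [NormedAddCommGroup E] [NormedSpace ℝ E]
    {f g : ℝ × ℝ → E} (hf : IntegrableOn f cell) (hg : IntegrableOn g cell)
    (h : ∀ p ∈ cell, f p + f (reflect p) = g p + g (reflect p)) :
    ∫ p in cell, f p = ∫ p in cell, g p := by
  have key := setIntegral_congr_fun (μ := volume) measurableSet_cell h
  rw [integral_add hf (integrableOn_reflect hf), integral_add hg (integrableOn_reflect hg),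
    integral_reflect, integral_reflect, ← two_smul ℝ, ← two_smul ℝ] at key
  exact smul_right_injective E (two_ne_zero (α := ℝ)) key

theorem coinWeight_add_neg (γ : ℝ) (ν₀ ν₁ : ℂ) (q : ℝ × ℝ) :
    coinWeight γ ν₀ ν₁ q + coinWeight γ ν₀ ν₁ (-q) = 2 := by
  simp only [coinWeight, Prod.fst_neg, Prod.snd_neg]
  ring

/-- The deviation of the weight from 1 is odd under the reflection, so the mass is the area of the
cell over π². -/
theorem integral_limitDensity {γ : ℝ} (hc : Real.cos γ ≠ 0) (hs : Real.sin γ ≠ 0)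
    {ν₀ ν₁ : ℂ} (hν : ‖ν₀‖ ^ 2 + ‖ν₁‖ ^ 2 = 1) :
    ∫ p : ℝ × ℝ, limitDensity γ ν₀ ν₁ p.1 p.2 = 1 := by
  have h := integral_limitDensity_smul hc hs ν₀ ν₁ (fun _ => (1 : ℝ))
  simp only [smul_eq_mul, mul_one] at h
  rw [h, integral_eq_of_add_reflect_eq (g := fun _ => (1 : ℝ))
    (integrable_coinWeight_velocity hc hs hν) (integrable_const _)]
  · simp [volume_real_cell]
  · intro p _
    rw [velocity_reflect, coinWeight_add_neg]
    norm_num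

/-! ### Fourier transform of the walk -/

/-- The plane wave `exp (-i k·p)`. -/
noncomputable def wave (k : ℝ × ℝ) (p : ℤ × ℤ) : ℂ :=
  Complex.exp (((-(k.1 * p.1 + k.2 * p.2) : ℝ) : ℂ) * Complex.I)

/-- The Fourier transform of a state. -/
noncomputable def fourier (ψ : State) (k : ℝ × ℝ) : Fin 2 → ℂ :=
  fun j => ∑' p, ψ p j * wave k p

/-- The conditional shift in momentum space. -/
noncomputable def phaseMatrix (a : ℝ) : Matrix (Fin 2) (Fin 2) ℂ :=
  !![Complex.exp ((a : ℂ) * Complex.I), 0; 0, Complex.exp (-(a : ℂ) * Complex.I)]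

/-- One time step in momentum space. -/
noncomputable def walkMatrix (γ : ℝ) (k : ℝ × ℝ) : Matrix (Fin 2) (Fin 2) ℂ :=
  phaseMatrix k.2 * coin γ * (phaseMatrix k.1 * coin γ)

/-- States with finitely many occupied sites. -/
def FinitelySupported (ψ : State) : Prop := {p | ψ p ≠ 0}.Finite

theorem FinitelySupported.summable {ψ : State} (h : FinitelySupported ψ) (j : Fin 2)
    (g : ℤ × ℤ → ℂ) : Summable fun p => ψ p j * g p := by
  refine summable_of_hasFiniteSupport (h.subset fun p hp h0 => hp ?_)
  simp [h0]

theorem FinitelySupported.applyCoin {ψ : State} (h : FinitelySupported ψ) (γ : ℝ) :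
    FinitelySupported (applyCoin γ ψ) := by
  refine h.subset fun p hp h0 => hp ?_
  simp [AlternateWalk.applyCoin, h0]

theorem FinitelySupported.shiftX {ψ : State} (h : FinitelySupported ψ) :
    FinitelySupported (shiftX ψ) := by
  have h1 : Function.Injective fun p : ℤ × ℤ => (p.1 + 1, p.2) := by
    rintro ⟨a, b⟩ ⟨c, d⟩ h; simpa using h
  have h2 : Function.Injective fun p : ℤ × ℤ => (p.1 - 1, p.2) := by
    rintro ⟨a, b⟩ ⟨c, d⟩ h; simpa using h
  refine ((h.preimage h1.injOn).union (h.preimage h2.injOn)).subset fun p hp => ?_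
  by_contra hc
  simp only [Set.mem_union, Set.mem_preimage, Set.mem_ofPred_eq, not_or, not_not] at hc
  refine hp ?_
  ext j
  fin_cases j <;> simp [AlternateWalk.shiftX, hc.1, hc.2]

theorem FinitelySupported.shiftY {ψ : State} (h : FinitelySupported ψ) :
    FinitelySupported (shiftY ψ) := by
  have h1 : Function.Injective fun p : ℤ × ℤ => (p.1, p.2 + 1) := by
    rintro ⟨a, b⟩ ⟨c, d⟩ h; simpa using h
  have h2 : Function.Injective fun p : ℤ × ℤ => (p.1, p.2 - 1) := by
    rintro ⟨a, b⟩ ⟨c, d⟩ h; simpa using h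
  refine ((h.preimage h1.injOn).union (h.preimage h2.injOn)).subset fun p hp => ?_
  by_contra hc
  simp only [Set.mem_union, Set.mem_preimage, Set.mem_ofPred_eq, not_or, not_not] at hc
  refine hp ?_
  ext j
  fin_cases j <;> simp [AlternateWalk.shiftY, hc.1, hc.2]

theorem finitelySupported_state (γ : ℝ) (ν₀ ν₁ : ℂ) (t : ℕ) :
    FinitelySupported (state γ ν₀ ν₁ t) := by
  induction t with
  | zero =>
    refine (Set.finite_singleton ((0, 0) : ℤ × ℤ)).subset fun p hp => ?_
    by_contra hc
    refine hp ?_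
    have hc' : p ≠ (0, 0) := hc
    ext j
    fin_cases j <;> simp [state, initial, hc']
  | succ t ih =>
    simp only [state, Function.iterate_succ_apply', step]
    exact (((ih.applyCoin γ).shiftX).applyCoin γ).shiftY

/-- Each time step changes both coordinates by ±1. Differences of occupied sites are therefore even,
which permits Parseval on (0, π)². -/
theorem even_of_state_ne_zero (γ : ℝ) (ν₀ ν₁ : ℂ) (t : ℕ) :
    ∀ p, state γ ν₀ ν₁ t p ≠ 0 → Even (p.1 + t) ∧ Even (p.2 + t) := by
  induction t with
  | zero =>
    intro p hp
    by_cases h : p = (0, 0)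
    · simp [h]
    · exact absurd (by ext j; fin_cases j <;> simp [state, initial, h]) hp
  | succ t ih =>
    intro p hp
    by_contra hc
    have h0 : ∀ q : ℤ × ℤ, (q.1 = p.1 + 1 ∨ q.1 = p.1 - 1) → (q.2 = p.2 + 1 ∨ q.2 = p.2 - 1) →
        state γ ν₀ ν₁ t q = 0 := by
      intro q h1 h2
      by_contra hq
      have := ih q hq
      refine hc ?_
      push_cast
      simp only [Int.even_iff] at this ⊢
      omega
    refine hp ?_
    simp only [state, Function.iterate_succ_apply'] at h0 ⊢
    simp only [step]
    ext j
    fin_cases j <;>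
      simp [AlternateWalk.shiftX, AlternateWalk.shiftY, AlternateWalk.applyCoin, Matrix.mulVec,
        dotProduct, h0]

theorem fourier_applyCoin {ψ : State} (h : FinitelySupported ψ) (γ : ℝ) (k : ℝ × ℝ) :
    fourier (applyCoin γ ψ) k = (coin γ).mulVec (fourier ψ k) := by
  ext j
  simp only [fourier, applyCoin, Matrix.mulVec, dotProduct, Fin.sum_univ_two]
  rw [← tsum_mul_left, ← tsum_mul_left, ← ((h.summable 0 _).mul_left _).tsum_add
    ((h.summable 1 _).mul_left _)]
  exact tsum_congr fun p => by ring

theorem fourier_shiftX (ψ : State) (k : ℝ × ℝ) :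
    fourier (shiftX ψ) k = (phaseMatrix k.1).mulVec (fourier ψ k) := by
  ext j
  fin_cases j
  · simp only [fourier, shiftX, phaseMatrix, Matrix.mulVec, dotProduct, Fin.sum_univ_two]
    simp only [Fin.zero_eta, Matrix.of_apply, Matrix.cons_val_zero, Matrix.cons_val_one,
      zero_mul, add_zero]
    rw [← tsum_mul_left]
    refine Eq.trans ?_ ((Equiv.prodCongr (Equiv.addRight (1 : ℤ)) (Equiv.refl ℤ)).tsum_eq _)
    refine tsum_congr fun p => ?_
    simp only [Equiv.prodCongr_apply, Prod.map, Equiv.coe_addRight, Equiv.refl_apply]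
    rw [mul_left_comm, wave, wave, ← Complex.exp_add]
    congr 2
    push_cast
    ring
  · simp only [fourier, shiftX, phaseMatrix, Matrix.mulVec, dotProduct, Fin.sum_univ_two]
    simp only [Fin.mk_one, Matrix.of_apply, Matrix.cons_val_zero, Matrix.cons_val_one,
      zero_mul, zero_add]
    rw [← tsum_mul_left]
    refine Eq.trans ?_ ((Equiv.prodCongr (Equiv.subRight (1 : ℤ)) (Equiv.refl ℤ)).tsum_eq _)
    refine tsum_congr fun p => ?_
    simp only [Equiv.prodCongr_apply, Prod.map, Equiv.subRight_apply, Equiv.refl_apply]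
    rw [mul_left_comm, wave, wave, ← Complex.exp_add]
    congr 2
    push_cast
    ring

theorem fourier_shiftY (ψ : State) (k : ℝ × ℝ) :
    fourier (shiftY ψ) k = (phaseMatrix k.2).mulVec (fourier ψ k) := by
  ext j
  fin_cases j
  · simp only [fourier, shiftY, phaseMatrix, Matrix.mulVec, dotProduct, Fin.sum_univ_two]
    simp only [Fin.zero_eta, Matrix.of_apply, Matrix.cons_val_zero, Matrix.cons_val_one,
      zero_mul, add_zero]
    rw [← tsum_mul_left]
    refine Eq.trans ?_ ((Equiv.prodCongr (Equiv.refl ℤ) (Equiv.addRight (1 : ℤ))).tsum_eq _)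
    refine tsum_congr fun p => ?_
    simp only [Equiv.prodCongr_apply, Prod.map, Equiv.coe_addRight, Equiv.refl_apply]
    rw [mul_left_comm, wave, wave, ← Complex.exp_add]
    congr 2
    push_cast
    ring
  · simp only [fourier, shiftY, phaseMatrix, Matrix.mulVec, dotProduct, Fin.sum_univ_two]
    simp only [Fin.mk_one, Matrix.of_apply, Matrix.cons_val_zero, Matrix.cons_val_one,
      zero_mul, zero_add]
    rw [← tsum_mul_left]
    refine Eq.trans ?_ ((Equiv.prodCongr (Equiv.refl ℤ) (Equiv.subRight (1 : ℤ))).tsum_eq _)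
    refine tsum_congr fun p => ?_
    simp only [Equiv.prodCongr_apply, Prod.map, Equiv.subRight_apply, Equiv.refl_apply]
    rw [mul_left_comm, wave, wave, ← Complex.exp_add]
    congr 2
    push_cast
    ring

theorem fourier_initial (ν₀ ν₁ : ℂ) (k : ℝ × ℝ) :
    fourier (initial ν₀ ν₁) k = ![ν₀, ν₁] := by
  ext j
  rw [fourier, tsum_eq_single ((0, 0) : ℤ × ℤ)]
  · simp [initial, wave]
  · intro p hp
    fin_cases j <;> simp [initial, hp]

theorem fourier_state (γ : ℝ) (ν₀ ν₁ : ℂ) (t : ℕ) (k : ℝ × ℝ) :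
    fourier (state γ ν₀ ν₁ t) k = (walkMatrix γ k ^ t).mulVec ![ν₀, ν₁] := by
  induction t with
  | zero => simp [state, fourier_initial]
  | succ t ih =>
    have h := finitelySupported_state γ ν₀ ν₁ t
    rw [pow_succ', ← Matrix.mulVec_mulVec, ← ih]
    simp only [state, Function.iterate_succ_apply'] at h ⊢
    rw [step, fourier_shiftY, fourier_applyCoin (h.applyCoin γ).shiftX, fourier_shiftX,
      fourier_applyCoin h, Matrix.mulVec_mulVec, Matrix.mulVec_mulVec, Matrix.mulVec_mulVec,
      walkMatrix, mul_assoc]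

/-! ### Parseval's identity on the square (0, π)² -/

/-- A nonzero even frequency completes whole periods on an interval of length π. -/
theorem integral_exp_even (n : ℤ) (hn : Even n) :
    ∫ x in Set.Ioo 0 Real.pi, Complex.exp (((x * n : ℝ) : ℂ) * Complex.I) =
      if n = 0 then (Real.pi : ℂ) else 0 := by
  split_ifs with h
  · simp [h, Real.pi_pos.le]
  · obtain ⟨m, rfl⟩ := hn
    rw [← integral_Ioc_eq_integral_Ioo, ← intervalIntegral.integral_of_le Real.pi_pos.le]
    have h0 : ((m + m : ℤ) : ℂ) * Complex.I ≠ 0 :=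
      mul_ne_zero (Int.cast_ne_zero.2 h) Complex.I_ne_zero
    have e := integral_exp_mul_complex (a := 0) (b := Real.pi) h0
    have e2 : Complex.exp (((m + m : ℤ) : ℂ) * Complex.I * (Real.pi : ℝ)) = 1 := by
      rw [← Complex.exp_int_mul_two_pi_mul_I m]
      congr 1
      push_cast
      ring
    rw [e2] at e
    simp only [Complex.ofReal_zero, mul_zero, Complex.exp_zero, sub_self, zero_div] at e
    rw [← e]
    congr 1
    ext x
    congr 1
    push_cast
    ring

theorem integral_cell_exp_even (n : ℤ × ℤ) (h1 : Even n.1) (h2 : Even n.2) :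
    ∫ k in cell, Complex.exp (((k.1 * n.1 + k.2 * n.2 : ℝ) : ℂ) * Complex.I) =
      if n = 0 then (Real.pi : ℂ) ^ 2 else 0 := by
  have e : (fun k : ℝ × ℝ => Complex.exp (((k.1 * n.1 + k.2 * n.2 : ℝ) : ℂ) * Complex.I)) =
      fun k => Complex.exp (((k.1 * n.1 : ℝ) : ℂ) * Complex.I) *
        Complex.exp (((k.2 * n.2 : ℝ) : ℂ) * Complex.I) := by
    ext k
    rw [← Complex.exp_add]
    congr 1
    push_cast
    ring
  rw [e, cell, Measure.volume_eq_prod, setIntegral_prod_mul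
    (fun x : ℝ => Complex.exp (((x * n.1 : ℝ) : ℂ) * Complex.I))
    (fun x : ℝ => Complex.exp (((x * n.2 : ℝ) : ℂ) * Complex.I)),
    integral_exp_even _ h1, integral_exp_even _ h2]
  by_cases a : n.1 = 0 <;> by_cases b : n.2 = 0 <;> simp [a, b, Prod.ext_iff, sq]

theorem conj_wave_mul_wave (k h : ℝ × ℝ) (p q : ℤ × ℤ) :
    star (wave k p) * wave (k - h) q =
      Complex.exp (((k.1 * (p - q).1 + k.2 * (p - q).2 : ℝ) : ℂ) * Complex.I) *
        Complex.exp (((h.1 * q.1 + h.2 * q.2 : ℝ) : ℂ) * Complex.I) := by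
  rw [wave, wave, Complex.star_def, ← Complex.exp_conj, ← Complex.exp_add, ← Complex.exp_add]
  congr 1
  simp only [map_mul, Complex.conj_ofReal, Complex.conj_I, Prod.fst_sub, Prod.snd_sub]
  push_cast
  ring

theorem fourier_eq_sum {ψ : State} {s : Finset (ℤ × ℤ)} (hs : ∀ p ∉ s, ψ p = 0) (k : ℝ × ℝ)
    (j : Fin 2) : fourier ψ k j = ∑ p ∈ s, ψ p j * wave k p :=
  tsum_eq_sum fun p hp => by simp [hs p hp]

/-- Parseval's identity for the characteristic function of the position distribution. -/
theorem tsum_siteProb_mul_exp {ψ : State} (hψ : FinitelySupported ψ)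
    (heven : ∀ p q, ψ p ≠ 0 → ψ q ≠ 0 → Even (p - q).1 ∧ Even (p - q).2) (h : ℝ × ℝ) :
    ∑' p : ℤ × ℤ, (siteProb ψ p : ℂ) *
        Complex.exp (((h.1 * p.1 + h.2 * p.2 : ℝ) : ℂ) * Complex.I) =
      ((Real.pi : ℂ) ^ 2)⁻¹ *
        ∫ k in cell, dotProduct (star (fourier ψ k)) (fourier ψ (k - h)) := by
  set s := hψ.toFinset
  have hs : ∀ p ∉ s, ψ p = 0 := fun p hp =>
    not_not.1 fun h0 => hp ((Set.Finite.mem_toFinset hψ).2 h0)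
  have hs' : ∀ p ∈ s, ψ p ≠ 0 := fun p hp => (Set.Finite.mem_toFinset hψ).1 hp
  have e : ∀ k, dotProduct (star (fourier ψ k)) (fourier ψ (k - h)) =
      ∑ j, ∑ p ∈ s, ∑ q ∈ s, (star (ψ p j) * ψ q j *
        Complex.exp (((h.1 * q.1 + h.2 * q.2 : ℝ) : ℂ) * Complex.I)) *
        Complex.exp (((k.1 * (p - q).1 + k.2 * (p - q).2 : ℝ) : ℂ) * Complex.I) := by
    intro k
    simp only [dotProduct, Pi.star_apply, fourier_eq_sum hs, star_sum, Finset.sum_mul_sum]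
    refine Finset.sum_congr rfl fun j _ => Finset.sum_congr rfl fun p _ =>
      Finset.sum_congr rfl fun q _ => ?_
    have := conj_wave_mul_wave k h p q
    rw [star_mul']
    linear_combination (star (ψ p j) * ψ q j) * this
  have hint : ∀ (c : ℂ) (n : ℤ × ℤ), IntegrableOn (fun k : ℝ × ℝ => c *
      Complex.exp (((k.1 * n.1 + k.2 * n.2 : ℝ) : ℂ) * Complex.I)) cell := by
    intro c n
    refine Integrable.const_mul (Integrable.of_bound (C := 1) ?_ ?_) c
    · exact (by fun_prop : Continuous fun k : ℝ × ℝ =>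
        Complex.exp (((k.1 * n.1 + k.2 * n.2 : ℝ) : ℂ) * Complex.I)).aestronglyMeasurable
    · exact Eventually.of_forall fun k => (Complex.norm_exp_ofReal_mul_I _).le
  have hpi : (Real.pi : ℂ) ≠ 0 := Complex.ofReal_ne_zero.2 Real.pi_ne_zero
  simp_rw [e]
  rw [integral_finsetSum _ fun j _ => integrable_finsetSum _ fun p _ =>
    integrable_finsetSum _ fun q _ => hint _ _]
  simp_rw [integral_finsetSum s fun p _ => integrable_finsetSum s fun q _ => hint _ _,
    integral_finsetSum s fun q _ => hint _ _, integral_const_mul]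
  -- Orthogonality: p - q is even by `heven`, so only the diagonal terms p = q survive, each with
  -- the factor π².
  have e2 : ∀ j : Fin 2, (∑ p ∈ s, ∑ q ∈ s, (star (ψ p j) * ψ q j *
        Complex.exp (((h.1 * q.1 + h.2 * q.2 : ℝ) : ℂ) * Complex.I)) *
        ∫ k in cell, Complex.exp (((k.1 * (p - q).1 + k.2 * (p - q).2 : ℝ) : ℂ) * Complex.I)) =
      ∑ p ∈ s, (star (ψ p j) * ψ p j *
        Complex.exp (((h.1 * p.1 + h.2 * p.2 : ℝ) : ℂ) * Complex.I)) * (Real.pi : ℂ) ^ 2 := by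
    intro j
    refine Finset.sum_congr rfl fun p hp => ?_
    rw [Finset.sum_eq_single_of_mem p hp]
    · rw [integral_cell_exp_even _ (by simp) (by simp)]
      simp
    · intro q hq hqp
      have := heven p q (hs' p hp) (hs' q hq)
      rw [integral_cell_exp_even _ this.1 this.2, if_neg (sub_ne_zero.2 hqp.symm), mul_zero]
  simp_rw [e2]
  rw [tsum_eq_sum (s := s) fun p hp => by simp [siteProb, hs p hp], Finset.sum_comm,
    Finset.mul_sum]
  refine Finset.sum_congr rfl fun p _ => ?_
  rw [← Finset.sum_mul, ← Finset.sum_mul, siteProb]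
  have e3 : ((∑ j, ‖ψ p j‖ ^ 2 : ℝ) : ℂ) = ∑ j, star (ψ p j) * ψ p j := by
    push_cast
    refine Finset.sum_congr rfl fun j _ => ?_
    rw [Complex.star_def, mul_comm, Complex.mul_conj, ← Complex.ofReal_pow, Complex.sq_norm]
  rw [e3]
  field_simp

/-! ### The time step as a rotation -/

/-- The trace-free part of the time step. -/
noncomputable def tracelessPart (γ : ℝ) (k : ℝ × ℝ) : Matrix (Fin 2) (Fin 2) ℂ :=
  !![(numY (coupling γ) k : ℂ) * Complex.I,
    ((2 * Real.cos γ * Real.sin γ * Real.sin k.1 : ℝ) : ℂ) * Complex.I *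
      ((Real.cos k.2 : ℂ) + (Real.sin k.2 : ℂ) * Complex.I);
    ((2 * Real.cos γ * Real.sin γ * Real.sin k.1 : ℝ) : ℂ) * Complex.I *
      ((Real.cos k.2 : ℂ) - (Real.sin k.2 : ℂ) * Complex.I),
    -((numY (coupling γ) k : ℂ) * Complex.I)]

theorem phaseMatrix_eq (a : ℝ) : phaseMatrix a =
    !![(Real.cos a : ℂ) + (Real.sin a : ℂ) * Complex.I, 0;
      0, (Real.cos a : ℂ) - (Real.sin a : ℂ) * Complex.I] := by
  rw [phaseMatrix, Complex.exp_mul_I, Complex.exp_mul_I, Complex.cos_neg, Complex.sin_neg,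
    Complex.ofReal_cos, Complex.ofReal_sin, neg_mul, sub_eq_add_neg]

/-- The coin has determinant -1 and occurs twice, and the phase matrices have determinant 1, so the
step lies in SU(2): a real scalar, half the trace, plus a traceless anti-Hermitian matrix. -/
theorem walkMatrix_eq (γ : ℝ) (k : ℝ × ℝ) :
    walkMatrix γ k = (phaseCos (coupling γ) k : ℂ) • 1 + tracelessPart γ k := by
  have h : (Real.sin γ : ℂ) ^ 2 + (Real.cos γ : ℂ) ^ 2 = 1 := by
    exact_mod_cast Real.sin_sq_add_cos_sq γ
  have hI := Complex.I_sq
  rw [walkMatrix, phaseMatrix_eq, phaseMatrix_eq, coin, tracelessPart, phaseCos, numY, coupling]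
  ext i j
  fin_cases i <;> fin_cases j <;>
    simp [Matrix.mul_apply, Fin.sum_univ_two, -Complex.ofReal_cos, -Complex.ofReal_sin]
  · linear_combination ((Real.cos k.1 : ℂ) * (Real.cos k.2 : ℂ) +
      Complex.I * ((Real.cos k.1 : ℂ) * (Real.sin k.2 : ℂ))) * h +
      (((Real.cos γ : ℂ) ^ 2 - (Real.sin γ : ℂ) ^ 2) *
        ((Real.sin k.1 : ℂ) * (Real.sin k.2 : ℂ))) * hI
  · ring
  · ring
  · linear_combination ((Real.cos k.1 : ℂ) * (Real.cos k.2 : ℂ) -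
      Complex.I * ((Real.cos k.1 : ℂ) * (Real.sin k.2 : ℂ))) * h +
      (((Real.cos γ : ℂ) ^ 2 - (Real.sin γ : ℂ) ^ 2) *
        ((Real.sin k.1 : ℂ) * (Real.sin k.2 : ℂ))) * hI

theorem tracelessPart_mul_self (γ : ℝ) (k : ℝ × ℝ) :
    tracelessPart γ k * tracelessPart γ k = -((1 - phaseCos (coupling γ) k ^ 2 : ℝ) : ℂ) • 1 := by
  have h : (Real.sin k.2 : ℂ) ^ 2 + (Real.cos k.2 : ℂ) ^ 2 = 1 := by
    exact_mod_cast Real.sin_sq_add_cos_sq k.2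
  have hI := Complex.I_sq
  rw [one_sub_phaseCos_sq', one_sub_coupling_sq, tracelessPart]
  ext i j
  fin_cases i <;> fin_cases j <;>
    simp [Matrix.mul_apply, Fin.sum_univ_two, -Complex.ofReal_cos, -Complex.ofReal_sin]
  · linear_combination ((numY (coupling γ) k : ℂ) ^ 2 +
      (2 * (Real.cos γ : ℂ) * (Real.sin γ : ℂ) * (Real.sin k.1 : ℂ)) ^ 2 *
        ((Real.cos k.2 : ℂ) ^ 2 - (Real.sin k.2 : ℂ) ^ 2 * (Complex.I ^ 2 - 1))) * hI -
      (2 * (Real.cos γ : ℂ) * (Real.sin γ : ℂ) * (Real.sin k.1 : ℂ)) ^ 2 * h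
  · ring
  · ring
  · linear_combination ((numY (coupling γ) k : ℂ) ^ 2 +
      (2 * (Real.cos γ : ℂ) * (Real.sin γ : ℂ) * (Real.sin k.1 : ℂ)) ^ 2 *
        ((Real.cos k.2 : ℂ) ^ 2 - (Real.sin k.2 : ℂ) ^ 2 * (Complex.I ^ 2 - 1))) * hI -
      (2 * (Real.cos γ : ℂ) * (Real.sin γ : ℂ) * (Real.sin k.1 : ℂ)) ^ 2 * h

theorem conjTranspose_tracelessPart (γ : ℝ) (k : ℝ × ℝ) :
    (tracelessPart γ k).conjTranspose = -tracelessPart γ k := by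
  rw [tracelessPart]
  ext i j
  fin_cases i <;> fin_cases j <;>
    simp [Matrix.conjTranspose_apply, -Complex.ofReal_cos, -Complex.ofReal_sin]
  left
  ring

/-- A matrix with square `-1` generates rotations. -/
theorem cos_smul_add_sin_smul_pow {J : Matrix (Fin 2) (Fin 2) ℂ} (hJ : J * J = -1) (θ : ℝ)
    (t : ℕ) :
    ((Real.cos θ : ℂ) • 1 + (Real.sin θ : ℂ) • J) ^ t =
      (Real.cos (t * θ) : ℂ) • 1 + (Real.sin (t * θ) : ℂ) • J := by
  induction t with
  | zero => simp
  | succ t ih =>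
    have e : ((t + 1 : ℕ) : ℝ) * θ = t * θ + θ := by push_cast; ring
    rw [pow_succ, ih, e, Real.cos_add, Real.sin_add]
    simp only [add_mul, mul_add, smul_mul_smul_comm, hJ, mul_one, one_mul, Complex.ofReal_add,
      Complex.ofReal_sub, Complex.ofReal_mul]
    module

/-- The quasi-energy. -/
noncomputable def phase (C : ℝ) (k : ℝ × ℝ) : ℝ := Real.arccos (phaseCos C k)

/-- The traceless part of the time step, normalized to have square `-1`. -/
noncomputable def rotor (γ : ℝ) (k : ℝ × ℝ) : Matrix (Fin 2) (Fin 2) ℂ :=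
  (((phaseSin (coupling γ) k)⁻¹ : ℝ) : ℂ) • tracelessPart γ k

theorem cos_phase {C : ℝ} {k : ℝ × ℝ} (hk : phaseCos C k ^ 2 < 1) :
    Real.cos (phase C k) = phaseCos C k := cos_arccos_of_sq_lt_one hk

theorem sin_phase (C : ℝ) (k : ℝ × ℝ) : Real.sin (phase C k) = phaseSin C k :=
  Real.sin_arccos _

theorem rotor_mul_self {γ : ℝ} {k : ℝ × ℝ} (hk : phaseCos (coupling γ) k ^ 2 < 1) :
    rotor γ k * rotor γ k = -1 := by
  have h : phaseSin (coupling γ) k ^ 2 = 1 - phaseCos (coupling γ) k ^ 2 :=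
    Real.sq_sqrt (by linarith)
  have h0 : phaseSin (coupling γ) k ≠ 0 := (Real.sqrt_pos.2 (by linarith)).ne'
  rw [rotor, smul_mul_smul_comm, tracelessPart_mul_self, ← h, smul_smul]
  have : (((phaseSin (coupling γ) k)⁻¹ : ℝ) : ℂ) * (((phaseSin (coupling γ) k)⁻¹ : ℝ) : ℂ) *
      -((phaseSin (coupling γ) k ^ 2 : ℝ) : ℂ) = -1 := by
    have h1 : (phaseSin (coupling γ) k : ℂ) ≠ 0 := Complex.ofReal_ne_zero.2 h0
    push_cast
    field_simp
  rw [this, neg_smul, one_smul]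

theorem conjTranspose_rotor (γ : ℝ) (k : ℝ × ℝ) : (rotor γ k).conjTranspose = -rotor γ k := by
  rw [rotor, Matrix.conjTranspose_smul, conjTranspose_tracelessPart, Complex.star_def,
    Complex.conj_ofReal, smul_neg]

theorem walkMatrix_pow {γ : ℝ} {k : ℝ × ℝ} (hk : phaseCos (coupling γ) k ^ 2 < 1) (t : ℕ) :
    walkMatrix γ k ^ t = (Real.cos (t * phase (coupling γ) k) : ℂ) • 1 +
      (Real.sin (t * phase (coupling γ) k) : ℂ) • rotor γ k := by
  have h0 : phaseSin (coupling γ) k ≠ 0 := (Real.sqrt_pos.2 (by linarith)).ne'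
  rw [← cos_smul_add_sin_smul_pow (rotor_mul_self hk), walkMatrix_eq, cos_phase hk, sin_phase,
    rotor, smul_smul, ← Complex.ofReal_mul, mul_inv_cancel₀ h0, Complex.ofReal_one, one_smul]

/-- With N the traceless part, (w - N)(w + N) = w² - N² = 1. Working with N instead of `rotor`
covers every wave number, as the bound on overlaps requires: k - h/t may leave the cell. -/
theorem conjTranspose_walkMatrix_mul_self (γ : ℝ) (k : ℝ × ℝ) :
    (walkMatrix γ k).conjTranspose * walkMatrix γ k = 1 := by
  rw [walkMatrix_eq, Matrix.conjTranspose_add, conjTranspose_tracelessPart,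
    Matrix.conjTranspose_smul, Matrix.conjTranspose_one, Complex.star_def, Complex.conj_ofReal]
  simp only [add_mul, mul_add, tracelessPart_mul_self, mul_one, one_mul,
    neg_mul, smul_mul_assoc, mul_smul_comm]
  have : ((1 - phaseCos (coupling γ) k ^ 2 : ℝ) : ℂ) =
    1 - (phaseCos (coupling γ) k : ℂ) ^ 2 := by push_cast; rfl
  rw [this]
  module

theorem star_mulVec_dotProduct_mulVec (A : Matrix (Fin 2) (Fin 2) ℂ) (u v : Fin 2 → ℂ) :
    dotProduct (star (A.mulVec u)) (A.mulVec v) =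
      dotProduct (star u) ((A.conjTranspose * A).mulVec v) := by
  rw [Matrix.star_mulVec, ← Matrix.dotProduct_mulVec, Matrix.mulVec_mulVec]

theorem star_dotProduct_walkMatrix_pow (γ : ℝ) (k : ℝ × ℝ) (t : ℕ) (v : Fin 2 → ℂ) :
    dotProduct (star ((walkMatrix γ k ^ t).mulVec v)) ((walkMatrix γ k ^ t).mulVec v) =
      dotProduct (star v) v := by
  induction t with
  | zero => simp
  | succ t ih =>
    rw [pow_succ', ← Matrix.mulVec_mulVec, star_mulVec_dotProduct_mulVec,
      conjTranspose_walkMatrix_mul_self, Matrix.one_mulVec, ih]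

theorem norm_star_dotProduct_le {u v : Fin 2 → ℂ} (hu : dotProduct (star u) u = 1)
    (hv : dotProduct (star v) v = 1) : ‖dotProduct (star u) v‖ ≤ 1 := by
  have key : ∀ w : Fin 2 → ℂ, dotProduct (star w) w = 1 → ‖w 0‖ ^ 2 + ‖w 1‖ ^ 2 = 1 := by
    intro w hw
    simp only [dotProduct, Fin.sum_univ_two, Pi.star_apply, Complex.star_def] at hw
    rw [mul_comm, Complex.mul_conj, mul_comm, Complex.mul_conj] at hw
    simp only [Complex.sq_norm]
    exact_mod_cast hw
  have h1 := key u hu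
  have h2 := key v hv
  simp only [dotProduct, Fin.sum_univ_two, Pi.star_apply]
  refine (norm_add_le _ _).trans ?_
  rw [norm_mul, norm_mul, norm_star, norm_star]
  nlinarith [sq_nonneg (‖u 0‖ - ‖v 0‖), sq_nonneg (‖u 1‖ - ‖v 1‖)]

theorem star_dotProduct_coin {ν₀ ν₁ : ℂ} (hν : ‖ν₀‖ ^ 2 + ‖ν₁‖ ^ 2 = 1) :
    dotProduct (star ![ν₀, ν₁]) ![ν₀, ν₁] = 1 := by
  simp only [dotProduct, Fin.sum_univ_two, Pi.star_apply, Complex.star_def, Matrix.cons_val_zero,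
    Matrix.cons_val_one]
  rw [mul_comm, Complex.mul_conj, mul_comm, Complex.mul_conj]
  simp only [Complex.sq_norm] at hν
  exact_mod_cast hν

/-! ### Ballistic limit of the overlaps -/

theorem hasFDerivAt_phase {C : ℝ} (hC : C ^ 2 < 1) {k : ℝ × ℝ} (hk : k ∈ cell) :
    HasFDerivAt (phase C) ((velocity C k).1 • ContinuousLinearMap.fst ℝ ℝ ℝ +
      (velocity C k).2 • ContinuousLinearMap.snd ℝ ℝ ℝ) k := by
  have h := phaseCos_sq_lt_one hC hk
  have h' := abs_lt.1 ((sq_lt_one_iff_abs_lt_one _).1 h)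
  convert! (Real.hasDerivAt_arccos h'.1.ne' h'.2.ne).comp_hasFDerivAt k
    (hasFDerivAt_phaseCos C k) using 1
  change _ = (-(1 / phaseSin C k)) • _
  ext <;> simp [velocity] <;> ring

theorem continuous_tracelessPart (γ : ℝ) : Continuous (tracelessPart γ) := by
  refine continuous_matrix fun i j => ?_
  have h : Continuous (numY (coupling γ)) := by unfold numY; fun_prop
  fin_cases i <;> fin_cases j <;> simp [tracelessPart] <;> fun_prop

theorem continuousAt_rotor {γ : ℝ} {k : ℝ × ℝ} (hk : phaseCos (coupling γ) k ^ 2 < 1) :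
    ContinuousAt (rotor γ) k := by
  have h0 : phaseSin (coupling γ) k ≠ 0 := (Real.sqrt_pos.2 (by linarith)).ne'
  exact (Complex.continuous_ofReal.continuousAt.comp
    ((continuous_phaseSin _).continuousAt.inv₀ h0)).smul (continuous_tracelessPart γ).continuousAt

theorem measurable_rotor_apply (γ : ℝ) (i j : Fin 2) : Measurable fun k => rotor γ k i j := by
  have h : Measurable fun k => tracelessPart γ k i j :=
    ((continuous_tracelessPart γ).matrix_elem i j).measurable
  exact (Complex.measurable_ofReal.comp (continuous_phaseSin _).measurable.inv).mul h

theorem continuous_walkMatrix (γ : ℝ) : Continuous (walkMatrix γ) := by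
  have h : walkMatrix γ = fun k => (phaseCos (coupling γ) k : ℂ) • 1 + tracelessPart γ k :=
    funext (walkMatrix_eq γ)
  rw [h]
  have h1 : Continuous (phaseCos (coupling γ)) := by unfold phaseCos; fun_prop
  exact ((Complex.continuous_ofReal.comp h1).smul continuous_const).add
    (continuous_tracelessPart γ)

/-- The expansion is arranged around J' = J: the first two terms involve only the phase difference y
- x, and the last two are errors that vanish as J' → J when J is also unitary on v. -/
theorem rotation_overlap {J J' : Matrix (Fin 2) (Fin 2) ℂ} (hJ : J.conjTranspose = -J)
    {v : Fin 2 → ℂ} (hv : dotProduct (star v) v = 1) (x y : ℝ) :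
    dotProduct (star (((Real.cos x : ℂ) • 1 + (Real.sin x : ℂ) • J).mulVec v))
        (((Real.cos y : ℂ) • 1 + (Real.sin y : ℂ) • J').mulVec v) =
      (Real.cos (y - x) : ℂ) + (Real.sin (y - x) : ℂ) * dotProduct (star v) (J.mulVec v) +
        (Real.cos x * Real.sin y : ℝ) *
          (dotProduct (star v) (J'.mulVec v) - dotProduct (star v) (J.mulVec v)) +
        (Real.sin x * Real.sin y : ℝ) *
          (dotProduct (star (J.mulVec v)) (J'.mulVec v) - 1) := by
  have e : dotProduct (star (J.mulVec v)) v = -dotProduct (star v) (J.mulVec v) := by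
    rw [Matrix.star_mulVec, ← Matrix.dotProduct_mulVec, hJ, Matrix.neg_mulVec, dotProduct_neg]
  rw [Matrix.add_mulVec, Matrix.add_mulVec, Matrix.smul_mulVec, Matrix.smul_mulVec,
    Matrix.smul_mulVec, Matrix.smul_mulVec, Matrix.one_mulVec, star_add, star_smul, star_smul,
    add_dotProduct, dotProduct_add, dotProduct_add]
  simp only [smul_dotProduct, dotProduct_smul, hv, e, Complex.star_def, Complex.conj_ofReal,
    Real.cos_sub, Real.sin_sub, smul_eq_mul]
  push_cast
  ring

/-- The ballistic limit of the overlap of evolved wave packets. -/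
theorem tendsto_overlap {γ : ℝ} (hC : coupling γ ^ 2 < 1) {k : ℝ × ℝ} (hk : k ∈ cell)
    (h : ℝ × ℝ) {v : Fin 2 → ℂ} (hv : dotProduct (star v) v = 1) :
    Tendsto (fun t : ℕ => dotProduct (star ((walkMatrix γ k ^ t).mulVec v))
        ((walkMatrix γ (k - (t : ℝ)⁻¹ • h) ^ t).mulVec v)) atTop
      (𝓝 ((Real.cos (h.1 * (velocity (coupling γ) k).1 + h.2 * (velocity (coupling γ) k).2) : ℂ) -
        (Real.sin (h.1 * (velocity (coupling γ) k).1 + h.2 * (velocity (coupling γ) k).2) : ℂ) *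
          dotProduct (star v) ((rotor γ k).mulVec v))) := by
  set C := coupling γ
  have hw := phaseCos_sq_lt_one hC hk
  set kt : ℕ → ℝ × ℝ := fun t => k - (t : ℝ)⁻¹ • h
  have hkt : Tendsto kt atTop (𝓝 k) := by
    have : Tendsto (fun t : ℕ => k - (t : ℝ)⁻¹ • h) atTop (𝓝 (k - (0 : ℝ) • h)) :=
      tendsto_const_nhds.sub (tendsto_inv_atTop_nhds_zero_nat.smul_const h)
    simpa using this
  -- The phase difference is a difference quotient of θ in the direction -h with step 1/t.
  have hphase : Tendsto (fun t : ℕ => (t : ℝ) * phase C (kt t) - t * phase C k) atTop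
      (𝓝 (-(h.1 * (velocity C k).1 + h.2 * (velocity C k).2))) := by
    have := (hasFDerivAt_phase hC hk).lim (-h) (c := fun t : ℕ => (t : ℝ)) (l := atTop)
      (by simpa using tendsto_natCast_atTop_atTop (R := ℝ))
    convert this using 2
    · simp [kt, sub_eq_add_neg, mul_add]
    · simp
      ring
  -- The shifted wave number only has to avoid the degenerate set where sin θ = 0.
  have hev : ∀ᶠ t in atTop, phaseCos C (kt t) ^ 2 < 1 := by
    have h1 : Continuous (phaseCos C) := by unfold phaseCos; fun_prop
    exact ((h1.pow 2).continuousAt.tendsto.comp hkt).eventually (gt_mem_nhds hw)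
  have hJ : Tendsto (fun t => rotor γ (kt t)) atTop (𝓝 (rotor γ k)) :=
    (continuousAt_rotor hw).tendsto.comp hkt
  have hb : ∀ u : Fin 2 → ℂ, Tendsto (fun t => dotProduct u ((rotor γ (kt t)).mulVec v)) atTop
      (𝓝 (dotProduct u ((rotor γ k).mulVec v))) := by
    intro u
    have : Continuous fun M : Matrix (Fin 2) (Fin 2) ℂ => dotProduct u (M.mulVec v) := by fun_prop
    exact (this.tendsto _).comp hJ
  have hone : dotProduct (star ((rotor γ k).mulVec v)) ((rotor γ k).mulVec v) = 1 := by
    rw [star_mulVec_dotProduct_mulVec, conjTranspose_rotor, neg_mul, rotor_mul_self hw, neg_neg,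
      Matrix.one_mulVec, hv]
  -- The coefficients of the error terms oscillate and need not converge; they are merely bounded.
  have hsmall : ∀ (f : ℕ → ℂ) (z : ℂ) (a : ℕ → ℝ), Tendsto f atTop (𝓝 z) → (∀ t, |a t| ≤ 1) →
      Tendsto (fun t => (a t : ℂ) * (f t - z)) atTop (𝓝 0) := by
    intro f z a hf ha
    refine squeeze_zero_norm (a := fun t => ‖f t - z‖) (fun t => ?_)
      (tendsto_iff_norm_sub_tendsto_zero.1 hf)
    rw [norm_mul, Complex.norm_real, Real.norm_eq_abs]
    exact mul_le_of_le_one_left (norm_nonneg _) (ha t)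
  have h1 := hsmall _ _ (fun t : ℕ => Real.cos (t * phase C k) * Real.sin (t * phase C (kt t)))
    (hb (star v)) (fun t => by
      rw [abs_mul]
      exact mul_le_one₀ (Real.abs_cos_le_one _) (abs_nonneg _) (Real.abs_sin_le_one _))
  have h2 := hsmall _ _ (fun t : ℕ => Real.sin (t * phase C k) * Real.sin (t * phase C (kt t)))
    (hb (star ((rotor γ k).mulVec v))) (fun t => by
      rw [abs_mul]
      exact mul_le_one₀ (Real.abs_sin_le_one _) (abs_nonneg _) (Real.abs_sin_le_one _))
  rw [hone] at h2
  have hc := (Complex.continuous_ofReal.tendsto _).comp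
    ((Real.continuous_cos.tendsto _).comp hphase)
  have hs := ((Complex.continuous_ofReal.tendsto _).comp
    ((Real.continuous_sin.tendsto _).comp hphase)).mul_const
      (dotProduct (star v) ((rotor γ k).mulVec v))
  have hlim := ((hc.add hs).add h1).add h2
  rw [Real.cos_neg, Real.sin_neg, Complex.ofReal_neg, neg_mul, ← sub_eq_add_neg, add_zero,
    add_zero] at hlim
  refine hlim.congr' ?_
  filter_upwards [hev] with t ht
  rw [walkMatrix_pow hw, walkMatrix_pow ht, rotation_overlap (conjTranspose_rotor γ k) hv]
  rfl

/-- Under the reflection `numY` changes sign, while sin k₁ is kept and e^{ik₂} becomes -e^{-ik₂}.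
The difference therefore retains only cos k₂ off the diagonal, and this is the expression in
`coinWeight_velocity`. -/
theorem rotor_form_sub_reflect (γ : ℝ) (ν₀ ν₁ : ℂ) (k : ℝ × ℝ) :
    dotProduct (star ![ν₀, ν₁]) ((rotor γ k).mulVec ![ν₀, ν₁]) -
        dotProduct (star ![ν₀, ν₁]) ((rotor γ (reflect k)).mulVec ![ν₀, ν₁]) =
      2 * Complex.I * ((1 - coinWeight γ ν₀ ν₁ (velocity (coupling γ) k) : ℝ) : ℂ) := by
  have e : ((ν₀ * star ν₁ + star ν₀ * ν₁).re : ℂ) = ν₀ * star ν₁ + star ν₀ * ν₁ := by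
    apply Complex.ext <;> simp
    ring
  have e0 : ((‖ν₀‖ ^ 2 : ℝ) : ℂ) = ν₀ * star ν₀ := by
    rw [Complex.star_def, Complex.mul_conj, Complex.sq_norm]
  have e1 : ((‖ν₁‖ ^ 2 : ℝ) : ℂ) = ν₁ * star ν₁ := by
    rw [Complex.star_def, Complex.mul_conj, Complex.sq_norm]
  have hy : numY (coupling γ) (reflect k) = -numY (coupling γ) k := by
    simp [reflect, numY]
    ring
  have hs : Real.sin (reflect k).1 = Real.sin k.1 := by simp [reflect]
  have hs2 : Real.sin (reflect k).2 = Real.sin k.2 := by simp [reflect]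
  have hc2 : Real.cos (reflect k).2 = -Real.cos k.2 := by simp [reflect]
  rw [coinWeight_velocity, sub_sub_cancel]
  simp only [rotor, tracelessPart, phaseSin_reflect, hy, hs, hs2, hc2, velocity, Complex.ofReal_add,
    Complex.ofReal_mul, Complex.ofReal_sub, e, e0, e1, Complex.ofReal_div, Complex.ofReal_inv,
    Complex.ofReal_neg, Matrix.smul_mulVec, dotProduct_smul, smul_eq_mul]
  simp only [dotProduct, Matrix.mulVec, Fin.sum_univ_two, Matrix.of_apply, Matrix.cons_val_zero,
    Matrix.cons_val_one, Pi.star_apply]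
  ring

/-! ### Limit of the characteristic functions -/

/-- Parseval's identity for the walk. -/
theorem tsum_siteProb_state (γ : ℝ) (ν₀ ν₁ : ℂ) (t : ℕ) (h : ℝ × ℝ) :
    ∑' p : ℤ × ℤ, (siteProb (state γ ν₀ ν₁ t) p : ℂ) *
        Complex.exp (((h.1 * p.1 + h.2 * p.2 : ℝ) : ℂ) * Complex.I) =
      ((Real.pi : ℂ) ^ 2)⁻¹ * ∫ k in cell,
        dotProduct (star ((walkMatrix γ k ^ t).mulVec ![ν₀, ν₁]))
          ((walkMatrix γ (k - h) ^ t).mulVec ![ν₀, ν₁]) := by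
  rw [tsum_siteProb_mul_exp (finitelySupported_state γ ν₀ ν₁ t)]
  · simp_rw [fourier_state]
  · intro p q hp hq
    have h1 := even_of_state_ne_zero γ ν₀ ν₁ t p hp
    have h2 := even_of_state_ne_zero γ ν₀ ν₁ t q hq
    simp only [Int.even_iff, Prod.fst_sub, Prod.snd_sub] at *
    omega

theorem norm_overlap_le (γ : ℝ) {v : Fin 2 → ℂ} (hv : dotProduct (star v) v = 1) (k k' : ℝ × ℝ)
    (t : ℕ) : ‖dotProduct (star ((walkMatrix γ k ^ t).mulVec v))
      ((walkMatrix γ k' ^ t).mulVec v)‖ ≤ 1 :=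
  norm_star_dotProduct_le (by rw [star_dotProduct_walkMatrix_pow, hv])
    (by rw [star_dotProduct_walkMatrix_pow, hv])

theorem continuous_overlap (γ : ℝ) (v : Fin 2 → ℂ) (h : ℝ × ℝ) (t : ℕ) :
    Continuous fun k => dotProduct (star ((walkMatrix γ k ^ t).mulVec v))
      ((walkMatrix γ (k - h) ^ t).mulVec v) := by
  have h1 := continuous_walkMatrix γ
  fun_prop

/-- The pointwise limit of the overlaps. -/
noncomputable def limitOverlap (γ : ℝ) (v : Fin 2 → ℂ) (h k : ℝ × ℝ) : ℂ :=
  (Real.cos (h.1 * (velocity (coupling γ) k).1 + h.2 * (velocity (coupling γ) k).2) : ℂ) -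
    (Real.sin (h.1 * (velocity (coupling γ) k).1 + h.2 * (velocity (coupling γ) k).2) : ℂ) *
      dotProduct (star v) ((rotor γ k).mulVec v)

theorem measurable_limitOverlap (γ : ℝ) (v : Fin 2 → ℂ) (h : ℝ × ℝ) :
    Measurable (limitOverlap γ v h) := by
  have h1 := measurable_velocity (coupling γ)
  have h2 := measurable_rotor_apply γ
  have hx : Measurable fun k => h.1 * (velocity (coupling γ) k).1 +
      h.2 * (velocity (coupling γ) k).2 := (h1.fst.const_mul _).add (h1.snd.const_mul _)
  have hrow : ∀ i, Measurable fun k => star v i * ((rotor γ k).mulVec v) i := fun i => by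
    simp only [Matrix.mulVec, dotProduct, Fin.sum_univ_two]
    exact (((h2 i 0).mul_const _).add ((h2 i 1).mul_const _)).const_mul _
  exact (Complex.measurable_ofReal.comp (Real.measurable_cos.comp hx)).sub
    ((Complex.measurable_ofReal.comp (Real.measurable_sin.comp hx)).mul
      (Finset.measurable_fun_sum _ fun i _ => hrow i))

theorem norm_limitOverlap_le {γ : ℝ} (hC : coupling γ ^ 2 < 1) {v : Fin 2 → ℂ}
    (hv : dotProduct (star v) v = 1) (h : ℝ × ℝ) {k : ℝ × ℝ} (hk : k ∈ cell) :
    ‖limitOverlap γ v h k‖ ≤ 1 :=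
  le_of_tendsto (tendsto_overlap hC hk h hv).norm
    (Eventually.of_forall fun t => norm_overlap_le γ hv _ _ t)

theorem tendsto_integral_overlap {γ : ℝ} (hC : coupling γ ^ 2 < 1) {v : Fin 2 → ℂ}
    (hv : dotProduct (star v) v = 1) (h : ℝ × ℝ) :
    Tendsto (fun t : ℕ => ∫ k in cell, dotProduct (star ((walkMatrix γ k ^ t).mulVec v))
        ((walkMatrix γ (k - (t : ℝ)⁻¹ • h) ^ t).mulVec v)) atTop
      (𝓝 (∫ k in cell, limitOverlap γ v h k)) := by
  refine tendsto_integral_of_dominated_convergence (fun _ => 1)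
    (fun t => (continuous_overlap γ v _ t).aestronglyMeasurable) (integrable_const _)
    (fun t => Eventually.of_forall fun k => norm_overlap_le γ hv _ _ t) ?_
  exact ae_restrict_of_forall_mem measurableSet_cell fun k hk => tendsto_overlap hC hk h hv

/-- The integrands need not agree pointwise, but their symmetrizations do. With x = h·∇θ and weight
g, both are 2 cos x - 2i (1 - g) sin x, the second one as g e^{ix} + (2 - g) e^{-ix}. -/
theorem integral_limitOverlap {γ : ℝ} (hc : Real.cos γ ≠ 0) (hs : Real.sin γ ≠ 0)
    {ν₀ ν₁ : ℂ} (hν : ‖ν₀‖ ^ 2 + ‖ν₁‖ ^ 2 = 1) (h : ℝ × ℝ) :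
    ((Real.pi : ℂ) ^ 2)⁻¹ * ∫ k in cell, limitOverlap γ ![ν₀, ν₁] h k =
      ∫ q : ℝ × ℝ, limitDensity γ ν₀ ν₁ q.1 q.2 •
        Complex.exp (((h.1 * q.1 + h.2 * q.2 : ℝ) : ℂ) * Complex.I) := by
  have hC := coupling_sq_lt_one hc hs
  rw [integral_limitDensity_smul hc hs, Complex.real_smul]
  push_cast
  congr 1
  have hv := star_dotProduct_coin hν
  refine integral_eq_of_add_reflect_eq ?_ ?_ fun k _ => ?_
  · exact Integrable.of_bound (C := 1) (measurable_limitOverlap γ _ h).aestronglyMeasurable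
      (ae_restrict_of_forall_mem measurableSet_cell fun k hk => norm_limitOverlap_le hC hv h hk)
  · have hvel := measurable_velocity (coupling γ)
    refine (integrable_coinWeight_velocity hc hs hν).smul_bdd (C := 1) ?_ ?_
    · exact ((by fun_prop : Continuous fun q : ℝ × ℝ => Complex.exp
        (((h.1 : ℂ) * (q.1 : ℂ) + (h.2 : ℂ) * (q.2 : ℂ)) * Complex.I)).measurable.comp
          hvel).aestronglyMeasurable
    · refine Eventually.of_forall fun k => ?_
      exact_mod_cast (Complex.norm_exp_ofReal_mul_I (h.1 * (velocity (coupling γ) k).1 +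
        h.2 * (velocity (coupling γ) k).2)).le
  · have key := rotor_form_sub_reflect γ ν₀ ν₁ k
    have hw := coinWeight_add_neg γ ν₀ ν₁ (velocity (coupling γ) k)
    simp only [limitOverlap, velocity_reflect, Prod.fst_neg, Prod.snd_neg, Complex.real_smul]
    rw [eq_sub_of_add_eq' hw]
    set x := h.1 * (velocity (coupling γ) k).1 + h.2 * (velocity (coupling γ) k).2 with hx
    have e1 : h.1 * -(velocity (coupling γ) k).1 + h.2 * -(velocity (coupling γ) k).2 = -x := by
      rw [hx]; ring
    have e2 : (h.1 : ℂ) * ((velocity (coupling γ) k).1 : ℂ) +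
        (h.2 : ℂ) * ((velocity (coupling γ) k).2 : ℂ) = (x : ℂ) := by
      rw [hx]; push_cast; rfl
    have e3 : (h.1 : ℂ) * ((-(velocity (coupling γ) k).1 : ℝ) : ℂ) +
        (h.2 : ℂ) * ((-(velocity (coupling γ) k).2 : ℝ) : ℂ) = ((-x : ℝ) : ℂ) := by
      rw [← e1]; push_cast; rfl
    rw [e1, e2, e3, Real.cos_neg, Real.sin_neg, Complex.exp_mul_I, Complex.exp_mul_I,
      ← Complex.ofReal_cos, ← Complex.ofReal_sin, ← Complex.ofReal_cos, ← Complex.ofReal_sin,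
      Real.cos_neg, Real.sin_neg]
    push_cast at key ⊢
    linear_combination (-(Complex.sin x)) * key

theorem tendsto_tsum_siteProb {γ : ℝ} (hc : Real.cos γ ≠ 0) (hs : Real.sin γ ≠ 0)
    {ν₀ ν₁ : ℂ} (hν : ‖ν₀‖ ^ 2 + ‖ν₁‖ ^ 2 = 1) (h : ℝ × ℝ) :
    Tendsto (fun t : ℕ => ∑' p : ℤ × ℤ, (siteProb (state γ ν₀ ν₁ t) p : ℂ) *
        Complex.exp ((((t : ℝ)⁻¹ * h.1 * p.1 + (t : ℝ)⁻¹ * h.2 * p.2 : ℝ) : ℂ) * Complex.I)) atTop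
      (𝓝 (∫ q : ℝ × ℝ, limitDensity γ ν₀ ν₁ q.1 q.2 •
        Complex.exp (((h.1 * q.1 + h.2 * q.2 : ℝ) : ℂ) * Complex.I))) := by
  rw [← integral_limitOverlap hc hs hν]
  refine ((tendsto_integral_overlap (coupling_sq_lt_one hc hs)
    (star_dotProduct_coin hν) h).const_mul _).congr fun t => ?_
  rw [← tsum_siteProb_state]
  rfl

/-! ### The limit law and weak convergence -/

theorem measurable_limitDensity (γ : ℝ) (ν₀ ν₁ : ℂ) :
    Measurable fun p : ℝ × ℝ => limitDensity γ ν₀ ν₁ p.1 p.2 := by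
  rw [limitDensity_eq_indicator]
  refine Measurable.indicator ?_ (measurableSet_ellipse γ)
  have := measurable_coinWeight γ ν₀ ν₁
  fun_prop

theorem isProbabilityMeasure_limitLaw {γ : ℝ} (hc : Real.cos γ ≠ 0) (hs : Real.sin γ ≠ 0)
    {ν₀ ν₁ : ℂ} (hν : ‖ν₀‖ ^ 2 + ‖ν₁‖ ^ 2 = 1) : IsProbabilityMeasure (limitLaw γ ν₀ ν₁) := by
  constructor
  rw [limitLaw, withDensity_apply _ MeasurableSet.univ, Measure.restrict_univ,
    ← ofReal_integral_eq_lintegral_ofReal (integrable_limitDensity hc hs hν)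
      (Eventually.of_forall fun p => limitDensity_nonneg hc hs hν p.1 p.2),
    integral_limitDensity hc hs hν, ENNReal.ofReal_one]

theorem integral_limitLaw {γ : ℝ} (hc : Real.cos γ ≠ 0) (hs : Real.sin γ ≠ 0)
    {ν₀ ν₁ : ℂ} (hν : ‖ν₀‖ ^ 2 + ‖ν₁‖ ^ 2 = 1) {E : Type*} [NormedAddCommGroup E]
    [NormedSpace ℝ E] (F : ℝ × ℝ → E) :
    ∫ q, F q ∂(limitLaw γ ν₀ ν₁) = ∫ q : ℝ × ℝ, limitDensity γ ν₀ ν₁ q.1 q.2 • F q := by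
  rw [limitLaw, integral_withDensity_eq_integral_toReal_smul
    (measurable_limitDensity γ ν₀ ν₁).ennreal_ofReal
    (Eventually.of_forall fun _ => ENNReal.ofReal_lt_top)]
  simp_rw [ENNReal.toReal_ofReal (limitDensity_nonneg hc hs hν _ _)]

/-- Lévy's continuity theorem in the plane, in coordinates. -/
theorem tendsto_of_tendsto_integral_exp {μ : ℕ → ProbabilityMeasure (ℝ × ℝ)}
    {μ₀ : ProbabilityMeasure (ℝ × ℝ)}
    (h : ∀ a : ℝ × ℝ, Tendsto
      (fun n => ∫ q, Complex.exp (((a.1 * q.1 + a.2 * q.2 : ℝ) : ℂ) * Complex.I)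
        ∂(μ n : Measure (ℝ × ℝ))) atTop
      (𝓝 (∫ q, Complex.exp (((a.1 * q.1 + a.2 * q.2 : ℝ) : ℂ) * Complex.I)
        ∂(μ₀ : Measure (ℝ × ℝ))))) :
    Tendsto μ atTop (𝓝 μ₀) := by
  -- `charFun` refers to an inner product, whereas `ℝ × ℝ` carries the sup norm. The laws are pushed
  -- to `WithLp 2`, and the limit is brought back by the continuous inverse.
  have hto : Continuous (WithLp.toLp 2 : ℝ × ℝ → WithLp 2 (ℝ × ℝ)) :=
    WithLp.prod_continuous_toLp 2 ℝ ℝ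
  have hof : Continuous (WithLp.ofLp : WithLp 2 (ℝ × ℝ) → ℝ × ℝ) :=
    WithLp.prod_continuous_ofLp 2 ℝ ℝ
  have hchar : ∀ (ν : ProbabilityMeasure (ℝ × ℝ)) (a : WithLp 2 (ℝ × ℝ)),
      charFun (ν.map hto.measurable.aemeasurable : Measure (WithLp 2 (ℝ × ℝ))) a =
        ∫ q, Complex.exp (((a.ofLp.1 * q.1 + a.ofLp.2 * q.2 : ℝ) : ℂ) * Complex.I)
          ∂(ν : Measure (ℝ × ℝ)) := by
    intro ν a
    rw [charFun_apply, ProbabilityMeasure.toMeasure_map, integral_map hto.measurable.aemeasurable]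
    · simp only [WithLp.prod_inner_apply, RCLike.inner_apply, conj_trivial]
    · exact (by fun_prop : Continuous fun x : WithLp 2 (ℝ × ℝ) =>
        Complex.exp ((inner ℝ x a : ℝ) * Complex.I)).aestronglyMeasurable
  have hlp : Tendsto (fun n => (μ n).map hto.measurable.aemeasurable) atTop
      (𝓝 (μ₀.map hto.measurable.aemeasurable)) := by
    refine ProbabilityMeasure.tendsto_of_tendsto_charFun fun a => ?_
    simp only [hchar]
    exact h a.ofLp
  have hback := ProbabilityMeasure.tendsto_map_of_tendsto_of_continuous _ _ hlp hof
  have hid : ∀ ν : ProbabilityMeasure (ℝ × ℝ),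
      (ν.map hto.measurable.aemeasurable).map hof.measurable.aemeasurable = ν := by
    intro ν
    apply Subtype.ext
    change Measure.map _ (Measure.map _ (ν : Measure (ℝ × ℝ))) = _
    rw [Measure.map_map hof.measurable hto.measurable]
    exact Measure.map_id
  simpa only [hid] using hback

theorem integral_positionPMF (γ : ℝ) {ν₀ ν₁ : ℂ} (hν : ‖ν₀‖ ^ 2 + ‖ν₁‖ ^ 2 = 1) (t : ℕ)
    (a : ℝ × ℝ) :
    ∫ p, Complex.exp (((a.1 * p.1 + a.2 * p.2 : ℝ) : ℂ) * Complex.I)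
        ∂(positionPMF γ ν₀ ν₁ hν t).toMeasure =
      ∑' p : ℤ × ℤ, (siteProb (state γ ν₀ ν₁ t) p : ℂ) *
        Complex.exp (((a.1 * p.1 + a.2 * p.2 : ℝ) : ℂ) * Complex.I) := by
  rw [PMF.integral_eq_tsum]
  · refine tsum_congr fun p => ?_
    have : ((positionPMF γ ν₀ ν₁ hν t) p).toReal = siteProb (state γ ν₀ ν₁ t) p :=
      ENNReal.toReal_ofReal (Finset.sum_nonneg fun _ _ => by positivity)
    rw [this, Complex.real_smul]
  · exact Integrable.of_bound (C := 1) (measurable_of_countable _).aestronglyMeasurable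
      (Eventually.of_forall fun p => (Complex.norm_exp_ofReal_mul_I _).le)

theorem limitLaw_real_Iic_prod {γ : ℝ} (hc : Real.cos γ ≠ 0) (hs : Real.sin γ ≠ 0)
    {ν₀ ν₁ : ℂ} (hν : ‖ν₀‖ ^ 2 + ‖ν₁‖ ^ 2 = 1) (x y : ℝ) :
    (limitLaw γ ν₀ ν₁).real (Set.Iic x ×ˢ Set.Iic y) =
      ∫ u in Set.Iic x, ∫ v in Set.Iic y, limitDensity γ ν₀ ν₁ u v := by
  have hS : MeasurableSet (Set.Iic x ×ˢ Set.Iic y) := measurableSet_Iic.prod measurableSet_Iic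
  have h1 := integral_limitLaw hc hs hν ((Set.Iic x ×ˢ Set.Iic y).indicator (1 : ℝ × ℝ → ℝ))
  have h2 : (fun q : ℝ × ℝ => limitDensity γ ν₀ ν₁ q.1 q.2 •
      (Set.Iic x ×ˢ Set.Iic y).indicator (1 : ℝ × ℝ → ℝ) q) =
      (Set.Iic x ×ˢ Set.Iic y).indicator fun q => limitDensity γ ν₀ ν₁ q.1 q.2 := by
    ext q
    by_cases hq : q ∈ Set.Iic x ×ˢ Set.Iic y
    · rw [Set.indicator_of_mem hq, Set.indicator_of_mem hq, Pi.one_apply, smul_eq_mul, mul_one]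
    · rw [Set.indicator_of_notMem hq, Set.indicator_of_notMem hq, smul_zero]
  rw [integral_indicator_one hS, h2, integral_indicator hS] at h1
  rw [h1, Measure.volume_eq_prod]
  exact setIntegral_prod (fun p : ℝ × ℝ => limitDensity γ ν₀ ν₁ p.1 p.2)
    (integrable_limitDensity hc hs hν).integrableOn

/-- A quadrant is convex, so its frontier is Lebesgue null. Hence the distribution functions
converge at every point. -/
theorem limitLaw_frontier_Iic_prod (γ : ℝ) (ν₀ ν₁ : ℂ) (x y : ℝ) :
    limitLaw γ ν₀ ν₁ (frontier (Set.Iic x ×ˢ Set.Iic y)) = 0 :=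
  withDensity_absolutelyContinuous _ _
    (((convex_Iic x).prod (convex_Iic y)).addHaar_frontier volume)

end AlternateWalk

/-! ### The limit theorem -/

theorem theorem3 (γ : ℝ) (hγ : γ ∈ Set.Ioo 0 (2 * Real.pi)) (hγ₁ : γ ≠ Real.pi / 2)
    (hγ₂ : γ ≠ Real.pi) (hγ₃ : γ ≠ 3 * Real.pi / 2)
    (ν₀ ν₁ : ℂ) (hν : ‖ν₀‖ ^ 2 + ‖ν₁‖ ^ 2 = 1)
    {Ω : ℕ → Type*} [∀ t, MeasurableSpace (Ω t)]
    (P : ∀ t, Measure (Ω t)) [∀ t, IsProbabilityMeasure (P t)]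
    (X Y : ∀ t, Ω t → ℤ)
    (hlaw : ∀ t, HasLaw (fun ω => (X t ω, Y t ω))
      (AlternateWalk.positionPMF γ ν₀ ν₁ hν t).toMeasure (P t)) :
    -- `f` is a probability density
    (∀ x y : ℝ, 0 ≤ AlternateWalk.limitDensity γ ν₀ ν₁ x y) ∧
    Integrable (fun p : ℝ × ℝ => AlternateWalk.limitDensity γ ν₀ ν₁ p.1 p.2) ∧
    (∫ p : ℝ × ℝ, AlternateWalk.limitDensity γ ν₀ ν₁ p.1 p.2) = 1 ∧
    -- convergence in distribution to the law with density `f`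
    (∃ _ : IsProbabilityMeasure (AlternateWalk.limitLaw γ ν₀ ν₁),
      TendstoInDistribution (fun (t : ℕ) (ω : Ω t) => ((X t ω : ℝ) / t, (Y t ω : ℝ) / t)) atTop
        (fun p : ℝ × ℝ => p) P (AlternateWalk.limitLaw γ ν₀ ν₁)) ∧
    -- convergence of the joint distribution functions, at every point
    (∀ x y : ℝ, Tendsto
      (fun t : ℕ => (P t).real {ω | (X t ω : ℝ) / t ≤ x ∧ (Y t ω : ℝ) / t ≤ y}) atTop
      (𝓝 (∫ u in Set.Iic x, ∫ v in Set.Iic y, AlternateWalk.limitDensity γ ν₀ ν₁ u v))) := by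
  have hs : Real.sin γ ≠ 0 := by
    intro h0
    obtain ⟨n, hn⟩ := Real.sin_eq_zero_iff.1 h0
    have hpi := Real.pi_pos
    have h1 : (0 : ℝ) < n := by
      by_contra hc
      nlinarith [hγ.1]
    have h2 : (n : ℝ) < 2 := by
      by_contra hc
      nlinarith [hγ.2]
    have h3 : n = 1 := by
      have : 0 < n := by exact_mod_cast h1
      have : n < 2 := by exact_mod_cast h2
      omega
    rw [h3] at hn
    exact hγ₂ (by simpa using hn.symm)
  have hc : Real.cos γ ≠ 0 := by
    intro h0
    obtain ⟨n, hn⟩ := Real.cos_eq_zero_iff.1 h0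
    have hpi := Real.pi_pos
    have h1 : (-1 : ℝ) < n := by
      by_contra hc
      nlinarith [hγ.1]
    have h2 : (n : ℝ) < 2 := by
      by_contra hc
      nlinarith [hγ.2]
    have h3 : n = 0 ∨ n = 1 := by
      have : -1 < n := by exact_mod_cast h1
      have : n < 2 := by exact_mod_cast h2
      omega
    rcases h3 with h3 | h3 <;> rw [h3] at hn
    · exact hγ₁ (by rw [hn]; push_cast; ring)
    · exact hγ₃ (by rw [hn]; push_cast; ring)
  have hprob := AlternateWalk.isProbabilityMeasure_limitLaw hc hs hν
  have hmeas : ∀ t, AEMeasurable (fun ω => ((X t ω : ℝ) / t, (Y t ω : ℝ) / t)) (P t) := fun t =>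
    (measurable_of_countable fun p : ℤ × ℤ =>
      ((p.1 : ℝ) / t, (p.2 : ℝ) / t)).comp_aemeasurable (hlaw t).aemeasurable
  have hdist : TendstoInDistribution
      (fun (t : ℕ) (ω : Ω t) => ((X t ω : ℝ) / t, (Y t ω : ℝ) / t)) atTop
      (fun p : ℝ × ℝ => p) P (AlternateWalk.limitLaw γ ν₀ ν₁) := by
    refine ⟨hmeas, aemeasurable_id, ?_⟩
    refine AlternateWalk.tendsto_of_tendsto_integral_exp fun a => ?_
    simp only [ProbabilityMeasure.coe_mk]
    have hid : Measure.map (fun p : ℝ × ℝ => p) (AlternateWalk.limitLaw γ ν₀ ν₁) =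
        AlternateWalk.limitLaw γ ν₀ ν₁ := Measure.map_id
    rw [hid, AlternateWalk.integral_limitLaw hc hs hν]
    refine (AlternateWalk.tendsto_tsum_siteProb hc hs hν a).congr fun t => ?_
    have hcont : Continuous fun q : ℝ × ℝ =>
      Complex.exp (((a.1 * q.1 + a.2 * q.2 : ℝ) : ℂ) * Complex.I) := by fun_prop
    rw [integral_map (hmeas t) hcont.aestronglyMeasurable]
    -- Dividing the position by t amounts to evaluating its characteristic function at a/t. At t = 0
    -- both sides follow the convention 0⁻¹ = 0, so no case split is needed.
    have e1 := AlternateWalk.integral_positionPMF γ hν t ((t : ℝ)⁻¹ • a)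
    have e2 := (hlaw t).integral_comp (f := fun p : ℤ × ℤ => Complex.exp
      ((((t : ℝ)⁻¹ * a.1 * p.1 + (t : ℝ)⁻¹ * a.2 * p.2 : ℝ) : ℂ) * Complex.I))
      (measurable_of_countable _).aestronglyMeasurable
    simp only [Prod.smul_fst, Prod.smul_snd, smul_eq_mul] at e1
    rw [← e1, ← e2]
    refine integral_congr_ae (Eventually.of_forall fun ω => ?_)
    simp only [Function.comp_apply]
    congr 3
    ring
  refine ⟨AlternateWalk.limitDensity_nonneg hc hs hν,
    AlternateWalk.integrable_limitDensity hc hs hν, AlternateWalk.integral_limitDensity hc hs hν,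
    ⟨hprob, hdist⟩, fun x y => ?_⟩
  have hid : Measure.map (fun p : ℝ × ℝ => p) (AlternateWalk.limitLaw γ ν₀ ν₁) =
      AlternateWalk.limitLaw γ ν₀ ν₁ := Measure.map_id
  -- Portmanteau theorem for the quadrant.
  have h := ProbabilityMeasure.tendsto_measure_of_null_frontier_of_tendsto' hdist.tendsto
    (E := Set.Iic x ×ˢ Set.Iic y) (by
      simp only [ProbabilityMeasure.coe_mk]
      rw [hid]
      exact AlternateWalk.limitLaw_frontier_Iic_prod γ ν₀ ν₁ x y)
  simp only [ProbabilityMeasure.coe_mk] at h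
  rw [hid] at h
  rw [← AlternateWalk.limitLaw_real_Iic_prod hc hs hν]
  refine ((ENNReal.tendsto_toReal (measure_ne_top _ _)).comp h).congr fun t => ?_
  rw [Function.comp_apply, Measure.map_apply_of_aemeasurable (hmeas t)
    (measurableSet_Iic.prod measurableSet_Iic)]
  rfl
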